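/- Let $\mathbb H$ be the real quaternion algebra. The rank $r(M)$ of a matrix $M$ over $\mathbb H$ is the maximum number of right linearly independent columns of $M$, and $GL_k(\mathbb H)$ is the group of invertible $k\times k$ matrices. Let $A\in\mathbb H^{m\times n}$, $B\in\mathbb H^{m\times p_1}$, $C\in\mathbb H^{m\times p_2}$, $D\in\mathbb H^{m\times p_3}$, $E\in\mathbb H^{q_1\times n}$, $F\in\mathbb H^{q_2\times n}$, $G\in\mathbb H^{q_3\times n}$. Write $r_b=r(B)$, $r_{bc}=r(B,C)$, $r_{bcd}=r(B,C,D)$, $r_e=r(E)$, $r_{e|f}=r\begin{pmatrix}E\\F\end{pmatrix}$, $r_{e|f|g}=r\begin{pmatrix}E\\F\\G\end{pmatrix}$, and so on, and $$\rho=r\begin{pmatrix}D&B&0\\D&0&C\end{pmatrix},\qquad \sigma=r\begin{pmatrix}G&G\\E&0\\0&F\end{pmatrix}.$$ Put $$t=r\begin{pmatrix}A&B&C&D\\E&0&0&0\\F&0&0&0\\G&0&0&0\end{pmatrix}-r_{bcd}-r_{e|f|g},\qquad m_0=m-r_{bcd}-t,\qquad n_0=n-r_{e|f|g}-t,$$ $$m_1=r_b+r_c+r_d-\rho,\quad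 m_2=\rho-r_{bc}-r_d,\quad m_3=\rho-r_{bd}-r_c,\quad m_4=r_{bc}+r_{cd}+r_{bd}-r_{bcd}-\rho,$$ $$m_5=r_{bcd}-r_{cd},\quad m_6=\rho-r_{cd}-r_b,\quad m_7=r_{bcd}-r_{bd},\quad m_8=r_{bcd}-r_{bc},$$ $$n_1=r_e+r_f+r_g-\sigma,\quad n_2=\sigma-r_{e|f}-r_g,\quad n_3=\sigma-r_{e|g}-r_f,\quad n_4=r_{e|f}+r_{f|g}+r_{e|g}-r_{e|f|g}-\sigma,$$ $$n_5=r_{e|f|g}-r_{f|g},\quad n_6=\sigma-r_{f|g}-r_e,\quad n_7=r_{e|f|g}-r_{e|g},\quad n_8=r_{e|f|g}-r_{e|f}.$$ Then all these numbers are non-negative integers, and there exist $P\in GL_m(\mathbb H)$, $Q\in GL_n(\mathbb H)$, $T_i\in GL_{p_i}(\mathbb H)$, $V_i\in GL_{q_i}(\mathbb H)$ $(i=1,2,3)$ such that $$A=PS_AQ,\quad B=PS_BT_1,\quad C=PS_CT_2,\quad D=PS_DT_3,\quad E=V_1S_EQ,\quad F=V_2S_FQ,\quad G=V_3S_GQ,$$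 where, with row blocks of sizes $(m_1,m_2,m_3,m_4,m_5,m_4,m_6,m_7,m_8,m_0,t)$ in $S_A,S_B,S_C,S_D$ and column blocks of sizes $(n_1,n_2,n_3,n_4,n_5,n_4,n_6,n_7,n_8,n_0,t)$ in $S_A$, $$S_A=\begin{pmatrix}A_{11}&\cdots&A_{19}&A_{1,10}&0\\ \vdots&\ddots&\vdots&\vdots&\vdots\\ A_{91}&\cdots&A_{99}&A_{9,10}&0\\ A_{10,1}&\cdots&A_{10,9}&0&0\\ 0&\cdots&0&0&I_t\end{pmatrix}$$ for some matrices $A_{ij}$, and $$(S_B,S_C,S_D)=\begin{pmatrix}\begin{matrix}I&0&0&0&0&0\\0&I&0&0&0&0\\0&0&I&0&0&0\\0&0&0&I&0&0\\0&0&0&0&I&0\\0&0&0&0&0&0\\0&0&0&0&0&0\\0&0&0&0&0&0\\0&0&0&0&0&0\\0&0&0&0&0&0\\0&0&0&0&0&0\end{matrix}~&\begin{matrix}0&0&0&I&0&0\\0&0&0&0&I&0\\0&0&0&0&0&0\\0&0&0&0&0&0\\0&0&0&0&0&0\\I&0&0&0&0&0\\0&I&0&0&0&0\\0&0&I&0&0&0\\0&0&0&0&0&0\\0&0&0&0&0&0\\0&0&0&0&0&0\end{matrix}~&\begin{matrix}0&0&0&0&I&0\\0&0&0&0&0&0\\0&0&0&I&0&0\\0&I&0&0&0&0\\0&0&0&0&0&0\\0&I&0&0&0&0\\0&0&I&0&0&0\\0&0&0&0&0&0\\I&0&0&0&0&0\\0&0&0&0&0&0\\0&0&0&0&0&0\end{matrix}\end{pmatrix}$$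 with column blocks of sizes $(m_1,m_2,m_3,m_4,m_5,p_1-r_b)$ in $S_B$, $(m_4,m_6,m_7,m_1,m_2,p_2-r_c)$ in $S_C$ and $(m_8,m_4,m_6,m_3,m_1,p_3-r_d)$ in $S_D$. The matrix $(S_E^*,S_F^*,S_G^*)$, where $*$ is the conjugate transpose, has the same pattern of blocks $I$ and $0$, with every $m_i$ replaced by $n_i$ and with $p_1-r_b$, $p_2-r_c$, $p_3-r_d$ replaced by $q_1-r_e$, $q_2-r_f$, $q_3-r_g$. -/

import Mathlib

open Matrix
open scoped Quaternion

noncomputable section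

/-- The rank of a real quaternion matrix: the dimension of the right `ℍ`-vector space
spanned by its columns.  A right vector space over `ℍ` is a module over `ℍᵐᵒᵖ`, where
`MulOpposite.op a • v` is the column `v` multiplied by `a` on the right.  By
`qrank_isGreatest` it is the maximum number of right linearly independent columns. -/
def qrank {k l : Type*} (M : Matrix k l ℍ[ℝ]) : ℕ :=
  Module.finrank (ℍ[ℝ])ᵐᵒᵖ (Submodule.span (ℍ[ℝ])ᵐᵒᵖ (Set.range M.col))

/-- `qrank M` is the maximum number of right linearly independent columns of `M`. -/
theorem qrank_isGreatest {k l : Type*} [Fintype l] (M : Matrix k l ℍ[ℝ]) :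
    IsGreatest {r : ℕ | ∃ s : Finset l, s.card = r ∧
      LinearIndependent (ℍ[ℝ])ᵐᵒᵖ (fun j : s => M.col j)} (qrank M) := by
  classical
  have hfin : Module.Finite (ℍ[ℝ])ᵐᵒᵖ (Submodule.span (ℍ[ℝ])ᵐᵒᵖ (Set.range M.col)) :=
    Module.Finite.span_of_finite _ (Set.finite_range _)
  constructor
  · obtain ⟨κ, a, ha, hsp, hli⟩ := exists_linearIndependent' (ℍ[ℝ])ᵐᵒᵖ M.col
    have : Finite κ := Finite.of_injective a ha
    have : Fintype κ := Fintype.ofFinite κ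
    refine ⟨Finset.univ.map ⟨a, ha⟩, ?_, ?_⟩
    · rw [Finset.card_map, qrank, ← hsp, finrank_span_eq_card hli, Finset.card_univ]
    · have e := (Equiv.ofInjective a ha)
      rw [← linearIndependent_equiv ((Equiv.ofInjective a ha).trans
        (Equiv.setCongr (show Set.range a = ((Finset.univ.map ⟨a, ha⟩ : Finset l) : Set l) by
          ext; simp)))]
      exact hli
  · rintro r ⟨s, rfl, hli⟩
    have h := finrank_span_eq_card hli
    rw [Fintype.card_coe] at h
    rw [← h, qrank]
    apply Submodule.finrank_mono
    apply Submodule.span_mono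
    rintro _ ⟨j, rfl⟩
    exact ⟨j, rfl⟩

/-- A partition of `N` rows (or columns) into `k` consecutive blocks of sizes `s 0, s 1, …`:
the element `⟨i, x⟩` is the row with number `x` in block `i`. -/
def blockEquiv {k N : ℕ} (s : Fin k → ℕ) (h : ∑ i, s i = N) : (Σ i, Fin (s i)) ≃ Fin N :=
  finSigmaFinEquiv.trans (finCongr h)

/-- The `(i, j)` block of a block matrix. -/
def blk {a b : ℕ} {r : Fin a → ℕ} {c : Fin b → ℕ}
    (S : Matrix (Σ i, Fin (r i)) (Σ j, Fin (c j)) ℍ[ℝ]) (i : Fin a) (j : Fin b) :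
    Matrix (Fin (r i)) (Fin (c j)) ℍ[ℝ] :=
  S.submatrix (fun x => ⟨i, x⟩) (fun y => ⟨j, y⟩)

/-- The matrix with ones on the main diagonal and zeros elsewhere: the identity matrix
if `a = b` (and it is only used then). -/
def idBlock (a b : ℕ) : Matrix (Fin a) (Fin b) ℍ[ℝ] :=
  Matrix.of fun x y => if (x : ℕ) = (y : ℕ) then 1 else 0

theorem idBlock_self (a : ℕ) : idBlock a a = 1 := by
  refine Matrix.ext fun x y => ?_
  simp [idBlock, Matrix.one_apply, Fin.ext_iff]

/-- The matrix with row blocks of sizes `r i` and column blocks of sizes `c j` whose `(i, j)`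
block is `I` where the table `T` has a `1`, and `0` where it has a `0`. -/
def ofPattern {a b : ℕ} (T : Matrix (Fin a) (Fin b) ℕ) (r : Fin a → ℕ) (c : Fin b → ℕ) :
    Matrix (Σ i, Fin (r i)) (Σ j, Fin (c j)) ℍ[ℝ] :=
  Matrix.of fun x y => if T x.1 y.1 = 1 then idBlock (r x.1) (c y.1) x.2 y.2 else 0

/-- The table of identity blocks in `S_B` and in the conjugate transpose of `S_E`. -/
def pattern₁ : Matrix (Fin 11) (Fin 6) ℕ :=
  !![1, 0, 0, 0, 0, 0;
     0, 1, 0, 0, 0, 0;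
     0, 0, 1, 0, 0, 0;
     0, 0, 0, 1, 0, 0;
     0, 0, 0, 0, 1, 0;
     0, 0, 0, 0, 0, 0;
     0, 0, 0, 0, 0, 0;
     0, 0, 0, 0, 0, 0;
     0, 0, 0, 0, 0, 0;
     0, 0, 0, 0, 0, 0;
     0, 0, 0, 0, 0, 0]

/-- The table of identity blocks in `S_C` and in the conjugate transpose of `S_F`. -/
def pattern₂ : Matrix (Fin 11) (Fin 6) ℕ :=
  !![0, 0, 0, 1, 0, 0;
     0, 0, 0, 0, 1, 0;
     0, 0, 0, 0, 0, 0;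
     0, 0, 0, 0, 0, 0;
     0, 0, 0, 0, 0, 0;
     1, 0, 0, 0, 0, 0;
     0, 1, 0, 0, 0, 0;
     0, 0, 1, 0, 0, 0;
     0, 0, 0, 0, 0, 0;
     0, 0, 0, 0, 0, 0;
     0, 0, 0, 0, 0, 0]

/-- The table of identity blocks in `S_D` and in the conjugate transpose of `S_G`. -/
def pattern₃ : Matrix (Fin 11) (Fin 6) ℕ :=
  !![0, 0, 0, 0, 1, 0;
     0, 0, 0, 0, 0, 0;
     0, 0, 0, 1, 0, 0;
     0, 1, 0, 0, 0, 0;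
     0, 0, 0, 0, 0, 0;
     0, 1, 0, 0, 0, 0;
     0, 0, 1, 0, 0, 0;
     0, 0, 0, 0, 0, 0;
     1, 0, 0, 0, 0, 0;
     0, 0, 0, 0, 0, 0;
     0, 0, 0, 0, 0, 0]

/-- The eleven-part block sizes `(s₁, s₂, s₃, s₄, s₅, s₄, s₆, s₇, s₈, s₀, t)` shared by the rows
of `S_A, S_B, S_C, S_D` (and, with other values, by the columns of `S_A, S_E, S_F, S_G`). -/
def sizes (s₁ s₂ s₃ s₄ s₅ s₆ s₇ s₈ s₀ t : ℕ) : Fin 11 → ℕ :=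
  ![s₁, s₂, s₃, s₄, s₅, s₄, s₆, s₇, s₈, s₀, t]

/-- `S` has the block form
```
  * … *  *  0
  ⋮   ⋮  ⋮  ⋮
  * … *  *  0
  * … *  0  0
  0 … 0  0  I
```
with eleven block rows and eleven block columns; the blocks marked `*` are arbitrary. -/
def IsTrailingForm {r c : Fin 11 → ℕ}
    (S : Matrix (Σ i, Fin (r i)) (Σ j, Fin (c j)) ℍ[ℝ]) : Prop :=
  (∀ i, i ≠ 10 → blk S i 10 = 0) ∧ (∀ j, j ≠ 10 → blk S 10 j = 0) ∧
    blk S 9 9 = 0 ∧ blk S 10 10 = idBlock (r 10) (c 10)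

end

/-! ### Triples of subspaces of a finite-dimensional space over a division ring -/

section Subspaces

variable {K V : Type*} [DivisionRing K] [AddCommGroup V] [Module K V]

open Module Submodule

/-! Matrices with the same column space differ by an invertible right factor (`exists_GL_mul_eq`).
Hence normalising `B, C, D` by a common `P` only means choosing a basis adapted to their column
spaces b, c, d. A triple of subspaces is a sum of indecomposable ones: lines lying in a given subset
of {b, c, d}, and planes in which b, c, d are three distinct lines. The planes have multiplicity m₄
and produce the two identity blocks in one block column of `S_D`. The multiplicities come from the
dimension formula (`exists_triple_sizes`) and the basis from successive complements
(`exists_triple_families`). Families are only shown to span: since their total size is the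
dimension, they form a basis. Rows are treated by applying this to Eᴴ, Fᴴ, Gᴴ.

The matrix A is handled by using the freedom left in the bases. Let W = (B, C, D), let K be E, F, G
stacked, and let U have t columns in ker K whose images under A complete col W to col W + A(ker K);
the rank formula `qrank_fromBlocks_zero` identifies t. Take AU as the last block of columns of P.
The last rows of P⁻¹A then form a matrix Rᴴ with RᴴU = 1. Choose the basis for the row side with
last block R and all other columns in ker Uᴴ, which contains col Kᴴ because KU = 0. If Q denotes
this basis matrix, the last block row and block column of P⁻¹AQ⁻ᴴ are those of an identity. Its
tenth diagonal block vanishes because the tenth columns of Q⁻ᴴ lie in ker K, while the tenth rows of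
P⁻¹ annihilate col W + A(ker K). -/

theorem span_range_le_iff {k : ℕ} {f : Fin k → V} {W : Submodule K V} :
    span K (Set.range f) ≤ W ↔ ∀ i, f i ∈ W := by
  rw [span_le, Set.range_subset_iff]; rfl

variable [FiniteDimensional K V]

/-- A subspace can be enlarged to a bigger one by adjoining as many vectors as the dimensions
differ. -/
theorem exists_sup_span_range_eq {U W : Submodule K V} (h : U ≤ W) {k : ℕ}
    (hk : finrank K U + k = finrank K W) :
    ∃ f : Fin k → V, U ⊔ span K (Set.range f) = W := by
  obtain ⟨X, hd, hs⟩ := IsModularLattice.exists_disjoint_and_sup_eq h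
  have h1 := finrank_sup_add_finrank_inf_eq U X
  rw [hs, hd.eq_bot, finrank_bot] at h1
  have hX : finrank K X = k := by omega
  let e := finBasisOfFinrankEq K X hX
  refine ⟨fun i => (e i : V), ?_⟩
  have : span K (Set.range fun i => (e i : V)) = X := by
    have h2 := congrArg (Submodule.map X.subtype) e.span_eq
    rw [Submodule.map_span, ← Set.range_comp, Submodule.map_top, range_subtype] at h2
    exact h2
  rw [this, hs]

/-- The six dimension invariants of a triple of subspaces that only involve intersections
and sums of pairs. -/
theorem exists_triple_sizes (b c d : Submodule K V) :
    ∃ m₁ m₂ m₃ m₄ m₅ m₆ m₇ m₈ : ℕ,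
      m₁ = finrank K (b ⊓ c ⊓ d : Submodule K V) ∧
      finrank K b + finrank K c = finrank K (b ⊔ c : Submodule K V) + m₁ + m₂ ∧
      finrank K b + finrank K d = finrank K (b ⊔ d : Submodule K V) + m₁ + m₃ ∧
      finrank K c + finrank K d = finrank K (c ⊔ d : Submodule K V) + m₁ + m₆ ∧
      finrank K b = m₁ + m₂ + m₃ + m₄ + m₅ ∧
      finrank K c = m₁ + m₂ + m₆ + m₄ + m₇ ∧
      finrank K d = m₁ + m₃ + m₆ + m₄ + m₈ ∧
      finrank K (b ⊔ (c ⊔ d) : Submodule K V) = m₁ + m₂ + m₃ + m₄ + m₅ + m₄ + m₆ + m₇ + m₈ := by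
  have hbc := finrank_sup_add_finrank_inf_eq b c
  have hbd := finrank_sup_add_finrank_inf_eq b d
  have hcd := finrank_sup_add_finrank_inf_eq c d
  have hb := finrank_sup_add_finrank_inf_eq b (c ⊔ d)
  have hc := finrank_sup_add_finrank_inf_eq c (b ⊔ d)
  have hd := finrank_sup_add_finrank_inf_eq d (b ⊔ c)
  rw [show c ⊔ (b ⊔ d) = b ⊔ (c ⊔ d) by ac_rfl] at hc
  rw [show d ⊔ (b ⊔ c) = b ⊔ (c ⊔ d) by ac_rfl] at hd
  have h := finrank_sup_add_finrank_inf_eq (b ⊓ c) (b ⊓ d)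
  rw [show b ⊓ c ⊓ (b ⊓ d) = b ⊓ c ⊓ d by rw [← inf_inf_distrib_left, inf_assoc]] at h
  have l1 : finrank K (b ⊓ c ⊓ d : Submodule K V) ≤ finrank K (b ⊓ c : Submodule K V) :=
    finrank_mono inf_le_left
  have l2 : finrank K (b ⊓ c ⊓ d : Submodule K V) ≤ finrank K (b ⊓ d : Submodule K V) :=
    finrank_mono (inf_le_inf_right _ inf_le_left)
  have l3 : finrank K (b ⊓ c ⊓ d : Submodule K V) ≤ finrank K (c ⊓ d : Submodule K V) :=
    finrank_mono (inf_le_inf_right _ inf_le_right)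
  have l4 : finrank K (b ⊓ c ⊔ b ⊓ d : Submodule K V) ≤
      finrank K (b ⊓ (c ⊔ d) : Submodule K V) := finrank_mono le_inf_sup
  have l5 : finrank K (b ⊓ (c ⊔ d) : Submodule K V) ≤ finrank K b := finrank_mono inf_le_left
  have l6 : finrank K (c ⊓ (b ⊔ d) : Submodule K V) ≤ finrank K c := finrank_mono inf_le_left
  have l7 : finrank K (d ⊓ (b ⊔ c) : Submodule K V) ≤ finrank K d := finrank_mono inf_le_left
  -- The fourth number measures the failure of distributivity. It is computed from b, but by the
  -- dimension formula c and d give the same value. The bounds `l1` to `l7` make the truncated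
  -- subtractions genuine.
  refine ⟨finrank K (b ⊓ c ⊓ d : Submodule K V),
    finrank K (b ⊓ c : Submodule K V) - finrank K (b ⊓ c ⊓ d : Submodule K V),
    finrank K (b ⊓ d : Submodule K V) - finrank K (b ⊓ c ⊓ d : Submodule K V),
    finrank K (b ⊓ (c ⊔ d) : Submodule K V) - finrank K (b ⊓ c ⊔ b ⊓ d : Submodule K V),
    finrank K b - finrank K (b ⊓ (c ⊔ d) : Submodule K V),
    finrank K (c ⊓ d : Submodule K V) - finrank K (b ⊓ c ⊓ d : Submodule K V),
    finrank K c - finrank K (c ⊓ (b ⊔ d) : Submodule K V),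
    finrank K d - finrank K (d ⊓ (b ⊔ c) : Submodule K V), ?_, ?_, ?_, ?_, ?_, ?_, ?_, ?_⟩ <;> omega

/-- The decomposition of a triple of subspaces into indecomposable ones, in terms of spanning
families: `f₄` and `f₄'` come from the two-dimensional indecomposable triple, three lines in a
plane. -/
theorem exists_triple_families {b c d : Submodule K V} {m₁ m₂ m₃ m₄ m₅ m₆ m₇ m₈ : ℕ}
    (h₁ : m₁ = finrank K (b ⊓ c ⊓ d : Submodule K V))
    (hbc : finrank K b + finrank K c = finrank K (b ⊔ c : Submodule K V) + m₁ + m₂)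
    (hbd : finrank K b + finrank K d = finrank K (b ⊔ d : Submodule K V) + m₁ + m₃)
    (hcd : finrank K c + finrank K d = finrank K (c ⊔ d : Submodule K V) + m₁ + m₆)
    (hb : finrank K b = m₁ + m₂ + m₃ + m₄ + m₅)
    (hc : finrank K c = m₁ + m₂ + m₆ + m₄ + m₇)
    (hd : finrank K d = m₁ + m₃ + m₆ + m₄ + m₈)
    (hw : finrank K (b ⊔ (c ⊔ d) : Submodule K V) =
      m₁ + m₂ + m₃ + m₄ + m₅ + m₄ + m₆ + m₇ + m₈) :
    ∃ (f₁ : Fin m₁ → V) (f₂ : Fin m₂ → V) (f₃ : Fin m₃ → V) (f₄ : Fin m₄ → V) (f₅ : Fin m₅ → V)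
      (f₄' : Fin m₄ → V) (f₆ : Fin m₆ → V) (f₇ : Fin m₇ → V) (f₈ : Fin m₈ → V),
      b = span K (Set.range f₁) ⊔ span K (Set.range f₂) ⊔ span K (Set.range f₃) ⊔
        span K (Set.range f₄) ⊔ span K (Set.range f₅) ∧
      c = span K (Set.range f₁) ⊔ span K (Set.range f₂) ⊔ span K (Set.range f₆) ⊔
        span K (Set.range f₄') ⊔ span K (Set.range f₇) ∧
      d = span K (Set.range f₁) ⊔ span K (Set.range f₃) ⊔ span K (Set.range f₆) ⊔
        span K (Set.range (f₄ + f₄')) ⊔ span K (Set.range f₈) := by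
  have ebc := finrank_sup_add_finrank_inf_eq b c
  have ebd := finrank_sup_add_finrank_inf_eq b d
  have ecd := finrank_sup_add_finrank_inf_eq c d
  have eb := finrank_sup_add_finrank_inf_eq b (c ⊔ d)
  have ec := finrank_sup_add_finrank_inf_eq c (b ⊔ d)
  have ed := finrank_sup_add_finrank_inf_eq d (b ⊔ c)
  rw [show c ⊔ (b ⊔ d) = b ⊔ (c ⊔ d) by ac_rfl] at ec
  rw [show d ⊔ (b ⊔ c) = b ⊔ (c ⊔ d) by ac_rfl] at ed
  have e := finrank_sup_add_finrank_inf_eq (b ⊓ c) (b ⊓ d)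
  rw [show b ⊓ c ⊓ (b ⊓ d) = b ⊓ c ⊓ d by rw [← inf_inf_distrib_left, inf_assoc]] at e
  obtain ⟨f₁, s₁⟩ := exists_sup_span_range_eq (bot_le : ⊥ ≤ b ⊓ c ⊓ d) (k := m₁)
    (by rw [finrank_bot]; omega)
  rw [bot_sup_eq] at s₁
  obtain ⟨f₂, s₂⟩ := exists_sup_span_range_eq (U := b ⊓ c ⊓ d) (W := b ⊓ c) inf_le_left (k := m₂)
    (by omega)
  obtain ⟨f₃, s₃⟩ := exists_sup_span_range_eq (U := b ⊓ c ⊓ d) (W := b ⊓ d)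
    (inf_le_inf_right _ inf_le_left) (k := m₃) (by omega)
  obtain ⟨f₆, s₆⟩ := exists_sup_span_range_eq (U := b ⊓ c ⊓ d) (W := c ⊓ d)
    (inf_le_inf_right _ inf_le_right) (k := m₆) (by omega)
  obtain ⟨f₄, s₄⟩ := exists_sup_span_range_eq (U := b ⊓ c ⊔ b ⊓ d) (W := b ⊓ (c ⊔ d))
    le_inf_sup (k := m₄) (by omega)
  obtain ⟨f₅, s₅⟩ := exists_sup_span_range_eq (U := b ⊓ (c ⊔ d)) (W := b) inf_le_left (k := m₅)
    (by omega)
  obtain ⟨f₇, s₇⟩ := exists_sup_span_range_eq (U := c ⊓ (b ⊔ d)) (W := c) inf_le_left (k := m₇)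
    (by omega)
  obtain ⟨f₈, s₈⟩ := exists_sup_span_range_eq (U := d ⊓ (b ⊔ c)) (W := d) inf_le_left (k := m₈)
    (by omega)
  rw [← s₁] at s₂ s₃ s₆
  have hf₄ : ∀ i, f₄ i ∈ b ⊓ (c ⊔ d) := span_range_le_iff.1 (le_sup_right.trans s₄.le)
  -- Writing an element of `f₄` as a sum from c and d, the negative of the c-part goes into `f₄'`.
  -- The sums `f₄ + f₄'` then lie in d, which gives the three lines in a plane.
  have hy : ∀ i, ∃ y ∈ c, f₄ i + y ∈ d := fun i => by
    obtain ⟨y, hy, z, hz, hyz⟩ := mem_sup.1 (hf₄ i).2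
    exact ⟨-y, neg_mem hy, by rw [← hyz]; simpa using hz⟩
  choose f₄' hc₄ hd₄ using hy
  set g := f₄ + f₄' with hg
  have sg : span K (Set.range g) ≤ span K (Set.range f₄) ⊔ span K (Set.range f₄') :=
    span_range_le_iff.2 fun i => add_mem_sup (subset_span ⟨i, rfl⟩) (subset_span ⟨i, rfl⟩)
  have sf : span K (Set.range f₄) ≤ span K (Set.range g) ⊔ span K (Set.range f₄') :=
    span_range_le_iff.2 fun i => by
      have : f₄ i = g i + -f₄' i := by simp [hg]
      rw [this]
      exact add_mem_sup (subset_span ⟨i, rfl⟩) (neg_mem (subset_span ⟨i, rfl⟩))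
  have sf' : span K (Set.range f₄') ≤ span K (Set.range g) ⊔ span K (Set.range f₄) :=
    span_range_le_iff.2 fun i => by
      have : f₄' i = g i + -f₄ i := by simp [hg]
      rw [this]
      exact add_mem_sup (subset_span ⟨i, rfl⟩) (neg_mem (subset_span ⟨i, rfl⟩))
  have lc₄ : span K (Set.range f₄') ≤ c := span_range_le_iff.2 hc₄
  have ld₄ : span K (Set.range g) ≤ d := span_range_le_iff.2 hd₄
  have lb₄ : span K (Set.range f₄) ≤ b := span_range_le_iff.2 fun i => (hf₄ i).1
  -- `f₄'` plays for c the role that `f₄` plays for b. For an element x + z of c with x in b and z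
  -- in d, x is expanded by `s₄`, and its `f₄`-part is split into a part in d and a part in the span
  -- of `f₄'`. What remains besides b ⊓ c and that span lies in both c and d.
  have kc : c ⊓ (b ⊔ d) = b ⊓ c ⊔ c ⊓ d ⊔ span K (Set.range f₄') := by
    apply le_antisymm
    · rintro y ⟨hyc, hy⟩
      obtain ⟨x, hx, z, hz, rfl⟩ := mem_sup.1 hy
      have hx' : x ∈ b ⊓ (c ⊔ d) := ⟨hx, by
        have : x = (x + z) + -z := by simp
        rw [this]; exact add_mem_sup hyc (neg_mem hz)⟩
      rw [← s₄] at hx'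
      obtain ⟨u, hu, v, hv, rfl⟩ := mem_sup.1 hx'
      obtain ⟨u₁, hu₁, u₂, hu₂, rfl⟩ := mem_sup.1 hu
      obtain ⟨w, hw, y', hy', rfl⟩ := mem_sup.1 (sf hv)
      have key : u₂ + w + z ∈ c ⊓ d := by
        refine ⟨?_, add_mem (add_mem hu₂.2 (ld₄ hw)) hz⟩
        have : u₂ + w + z = (u₁ + u₂ + (w + y') + z) - u₁ - y' := by abel
        rw [this]
        exact sub_mem (sub_mem hyc hu₁.2) (lc₄ hy')
      have : u₁ + u₂ + (w + y') + z = u₁ + (u₂ + w + z) + y' := by abel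
      rw [this]
      exact add_mem_sup (add_mem_sup hu₁ key) hy'
    · refine sup_le (sup_le ?_ ?_) (le_inf lc₄ ?_)
      · exact le_inf inf_le_right (inf_le_left.trans le_sup_left)
      · exact le_inf inf_le_left (inf_le_right.trans le_sup_right)
      · exact sf'.trans (sup_le (ld₄.trans le_sup_right) (lb₄.trans le_sup_left))
  -- The same argument with c and d exchanged and `g` in place of `f₄'`.
  have kd : d ⊓ (b ⊔ c) = b ⊓ d ⊔ c ⊓ d ⊔ span K (Set.range g) := by
    apply le_antisymm
    · rintro z ⟨hzd, hz⟩
      obtain ⟨x, hx, y, hy, rfl⟩ := mem_sup.1 hz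
      have hx' : x ∈ b ⊓ (c ⊔ d) := ⟨hx, by
        have : x = -y + (x + y) := by simp
        rw [this]; exact add_mem_sup (neg_mem hy) hzd⟩
      rw [← s₄] at hx'
      obtain ⟨u, hu, v, hv, rfl⟩ := mem_sup.1 hx'
      obtain ⟨u₁, hu₁, u₂, hu₂, rfl⟩ := mem_sup.1 hu
      obtain ⟨w, hw, y', hy', rfl⟩ := mem_sup.1 (sf hv)
      have key : u₁ + y' + y ∈ c ⊓ d := by
        refine ⟨add_mem (add_mem hu₁.2 (lc₄ hy')) hy, ?_⟩
        have : u₁ + y' + y = (u₁ + u₂ + (w + y') + y) - u₂ - w := by abel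
        rw [this]
        exact sub_mem (sub_mem hzd hu₂.2) (ld₄ hw)
      have : u₁ + u₂ + (w + y') + y = u₂ + (u₁ + y' + y) + w := by abel
      rw [this]
      exact add_mem_sup (add_mem_sup hu₂ key) hw
    · refine sup_le (sup_le ?_ ?_) (le_inf ld₄ ?_)
      · exact le_inf inf_le_right (inf_le_left.trans le_sup_left)
      · exact le_inf inf_le_right (inf_le_left.trans le_sup_right)
      · exact sg.trans (sup_le (lb₄.trans le_sup_left) (lc₄.trans le_sup_right))
  refine ⟨f₁, f₂, f₃, f₄, f₅, f₄', f₆, f₇, f₈, ?_, ?_, ?_⟩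
  · rw [← s₄, ← s₂, ← s₃, ← sup_sup_distrib_left] at s₅
    rw [← s₅]; ac_rfl
  · rw [kc, ← s₂, ← s₆, ← sup_sup_distrib_left] at s₇
    rw [← s₇]; ac_rfl
  · rw [kd, ← s₃, ← s₆, ← sup_sup_distrib_left] at s₈
    rw [← s₈]; ac_rfl

/-- Two linear maps with the same range differ by an automorphism of the domain. -/
theorem exists_linearEquiv_comp_eq {W : Type*} [AddCommGroup W] [Module K W] (f g : V →ₗ[K] W)
    (h : LinearMap.range f = LinearMap.range g) : ∃ T : V ≃ₗ[K] V, ∀ x, f x = g (T x) := by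
  obtain ⟨X, hX⟩ := Submodule.exists_isCompl (LinearMap.ker f)
  obtain ⟨Y, hY⟩ := Submodule.exists_isCompl (LinearMap.ker g)
  have hr := f.finrank_range_add_finrank_ker
  have hr' := g.finrank_range_add_finrank_ker
  rw [h] at hr
  -- Equal ranges force kernels of equal dimension, and complements of the kernels are both
  -- identified with the common range. The two isomorphisms are glued.
  have e₁ : LinearMap.ker f ≃ₗ[K] LinearMap.ker g := LinearEquiv.ofFinrankEq _ _ (by omega)
  let e₂ : X ≃ₗ[K] Y :=
    (quotientEquivOfIsCompl _ _ hX).symm ≪≫ₗ f.quotKerEquivRange ≪≫ₗ LinearEquiv.ofEq _ _ h ≪≫ₗ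
      g.quotKerEquivRange.symm ≪≫ₗ quotientEquivOfIsCompl _ _ hY
  have he₂ : ∀ x : X, g (e₂ x) = f x := fun x => by
    have h1 : g.quotKerEquivRange ((quotientEquivOfIsCompl _ _ hY).symm (e₂ x)) =
        LinearEquiv.ofEq _ _ h (f.quotKerEquivRange ((quotientEquivOfIsCompl _ _ hX).symm x)) := by
      simp [e₂]
    simpa using congrArg Subtype.val h1
  refine ⟨(prodEquivOfIsCompl _ _ hX).symm ≪≫ₗ (e₁.prodCongr e₂) ≪≫ₗ prodEquivOfIsCompl _ _ hY,
    fun x => ?_⟩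
  obtain ⟨⟨u, v⟩, rfl⟩ := (prodEquivOfIsCompl _ _ hX).surjective x
  simp [he₂]

end Subspaces

/-! ### Column spaces and ranks of quaternion matrices -/

section MatrixRank

open Module Submodule

variable {k l l' l'' : Type*}

/-- The right vector space `ℍ` is one-dimensional. -/
noncomputable def opLinearEquivSelf : (ℍ[ℝ])ᵐᵒᵖ ≃ₗ[(ℍ[ℝ])ᵐᵒᵖ] ℍ[ℝ] where
  __ := MulOpposite.opAddEquiv.symm
  map_smul' _ _ := rfl

instance : Module.Finite (ℍ[ℝ])ᵐᵒᵖ ℍ[ℝ] := Module.Finite.equiv opLinearEquivSelf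

theorem finrank_op_pi (l : Type*) [Fintype l] :
    finrank (ℍ[ℝ])ᵐᵒᵖ (l → ℍ[ℝ]) = Fintype.card l := by
  rw [finrank_pi_fintype]
  simp [← opLinearEquivSelf.finrank_eq]

/-- The right vector space spanned by the columns of a quaternion matrix. -/
noncomputable abbrev colSpan (M : Matrix k l ℍ[ℝ]) : Submodule (ℍ[ℝ])ᵐᵒᵖ (k → ℍ[ℝ]) :=
  span (ℍ[ℝ])ᵐᵒᵖ (Set.range M.col)

theorem finrank_colSpan (M : Matrix k l ℍ[ℝ]) :
    finrank (ℍ[ℝ])ᵐᵒᵖ (colSpan M) = qrank M := rfl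

theorem colSpan_fromCols (M : Matrix k l ℍ[ℝ]) (N : Matrix k l' ℍ[ℝ]) :
    colSpan (fromCols M N) = colSpan M ⊔ colSpan N := by
  have : Set.range (fromCols M N).col = Set.range M.col ∪ Set.range N.col := by
    ext v
    simp only [Set.mem_range, Sum.exists, Set.mem_union]
    rfl
  rw [colSpan, this, span_union]

theorem qrank_fromCols (M : Matrix k l ℍ[ℝ]) (N : Matrix k l' ℍ[ℝ]) :
    qrank (fromCols M N) = finrank (ℍ[ℝ])ᵐᵒᵖ (colSpan M ⊔ colSpan N : Submodule _ _) := by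
  rw [← colSpan_fromCols]; rfl

theorem colSpan_zero : colSpan (0 : Matrix k l ℍ[ℝ]) = ⊥ := by
  rw [span_eq_bot]
  rintro _ ⟨j, rfl⟩
  rfl

variable [Fintype l]

/-- Left multiplication of columns by a matrix, as a map of right vector spaces. -/
noncomputable def mulVecRight (M : Matrix k l ℍ[ℝ]) : (l → ℍ[ℝ]) →ₗ[(ℍ[ℝ])ᵐᵒᵖ] (k → ℍ[ℝ]) where
  toFun := M.mulVec
  map_add' := M.mulVec_add
  map_smul' c v := M.mulVec_smul c v

@[simp] theorem mulVecRight_apply (M : Matrix k l ℍ[ℝ]) (v : l → ℍ[ℝ]) :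
    mulVecRight M v = M *ᵥ v := rfl

theorem colSpan_eq_range (M : Matrix k l ℍ[ℝ]) : colSpan M = LinearMap.range (mulVecRight M) := by
  classical
  apply le_antisymm
  · rw [span_le]
    rintro _ ⟨j, rfl⟩
    exact ⟨Pi.single j 1, by simp⟩
  · rintro _ ⟨v, rfl⟩
    have : mulVecRight M v = ∑ j, MulOpposite.op (v j) • M.col j := by
      ext i : 1
      simp [mulVec, dotProduct]
    rw [this]
    exact sum_mem fun j _ => smul_mem _ _ (subset_span ⟨j, rfl⟩)

theorem mem_colSpan_iff {M : Matrix k l ℍ[ℝ]} {v : k → ℍ[ℝ]} :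
    v ∈ colSpan M ↔ ∃ x, M *ᵥ x = v := by
  rw [colSpan_eq_range]; rfl

theorem mulVec_mem_colSpan (M : Matrix k l ℍ[ℝ]) (x : l → ℍ[ℝ]) : M *ᵥ x ∈ colSpan M :=
  mem_colSpan_iff.2 ⟨x, rfl⟩

theorem exists_mul_eq_of_colSpan_le {M : Matrix k l ℍ[ℝ]} {N : Matrix k l' ℍ[ℝ]}
    (h : colSpan N ≤ colSpan M) : ∃ L : Matrix l l' ℍ[ℝ], N = M * L := by
  have : ∀ j, ∃ x, M *ᵥ x = N.col j := fun j => mem_colSpan_iff.1 (h (subset_span ⟨j, rfl⟩))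
  choose x hx using this
  exact ⟨Matrix.of fun i j => x j i, Matrix.ext fun i j => (congrFun (hx j) i).symm⟩

variable [Fintype l'] [Fintype l'']

theorem qrank_add_finrank_ker (M : Matrix k l ℍ[ℝ]) :
    qrank M + finrank (ℍ[ℝ])ᵐᵒᵖ (LinearMap.ker (mulVecRight M)) = Fintype.card l := by
  rw [qrank, ← finrank_op_pi, ← (mulVecRight M).finrank_range_add_finrank_ker, ← colSpan_eq_range]

/-- The rank of a matrix with two block rows. -/
theorem qrank_fromRows (X : Matrix k l ℍ[ℝ]) {k' : Type*} (Y : Matrix k' l ℍ[ℝ]) :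
    qrank (fromRows X Y) = qrank Y + finrank (ℍ[ℝ])ᵐᵒᵖ
      (Submodule.map (mulVecRight X) (LinearMap.ker (mulVecRight Y))) := by
  -- Rank-nullity is used for the stacked matrix, for Y, and for X restricted to ker Y. The first
  -- and third kernels coincide.
  have h₁ := qrank_add_finrank_ker (fromRows X Y)
  have h₂ := qrank_add_finrank_ker Y
  have h₃ := ((mulVecRight X).domRestrict
    (LinearMap.ker (mulVecRight Y))).finrank_range_add_finrank_ker
  have h₄ : finrank (ℍ[ℝ])ᵐᵒᵖ (LinearMap.ker ((mulVecRight X).domRestrict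
      (LinearMap.ker (mulVecRight Y)))) =
      finrank (ℍ[ℝ])ᵐᵒᵖ (LinearMap.ker (mulVecRight (fromRows X Y))) := by
    rw [← finrank_map_subtype_eq]
    refine congrArg (fun W : Submodule (ℍ[ℝ])ᵐᵒᵖ (l → ℍ[ℝ]) => finrank (ℍ[ℝ])ᵐᵒᵖ W) ?_
    ext v
    simp only [Submodule.mem_map, LinearMap.mem_ker, LinearMap.domRestrict_apply,
      Submodule.subtype_apply, Subtype.exists, mulVecRight_apply, fromRows_mulVec]
    constructor
    · rintro ⟨w, hw, hX, rfl⟩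
      have hw' : Y *ᵥ w = 0 := hw
      rw [hX, hw']
      ext i : 1; rcases i with i | i <;> rfl
    · intro h
      exact ⟨v, funext fun i => congrFun h (Sum.inr i), funext fun i => congrFun h (Sum.inl i), rfl⟩
  have h₅ : LinearMap.range ((mulVecRight X).domRestrict (LinearMap.ker (mulVecRight Y))) =
      Submodule.map (mulVecRight X) (LinearMap.ker (mulVecRight Y)) :=
    LinearMap.range_domRestrict _ _
  rw [h₅] at h₃
  omega

theorem colSpan_mul_le (M : Matrix k l ℍ[ℝ]) (N : Matrix l l' ℍ[ℝ]) :
    colSpan (M * N) ≤ colSpan M := by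
  intro v hv
  obtain ⟨x, rfl⟩ := mem_colSpan_iff.1 hv
  rw [← mulVec_mulVec]
  exact mulVec_mem_colSpan _ _

theorem qrank_le_card (M : Matrix k l ℍ[ℝ]) : qrank M ≤ Fintype.card l := by
  have := qrank_add_finrank_ker M
  omega

/-- A basis of the column space gives a factorisation M = NL with `qrank M` columns in N, so Mᴴ =
LᴴNᴴ has its columns in the span of the `qrank M` columns of Lᴴ. Conjugation is essential: over ℍ
the plain transpose does not reverse products. -/
theorem qrank_conjTranspose_le [Fintype k] (M : Matrix k l ℍ[ℝ]) : qrank Mᴴ ≤ qrank M := by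
  let e := finBasis (ℍ[ℝ])ᵐᵒᵖ (colSpan M)
  let N : Matrix k (Fin (qrank M)) ℍ[ℝ] := Matrix.of fun i j => (e j : k → ℍ[ℝ]) i
  have h : colSpan M ≤ colSpan N := by
    have h2 := congrArg (Submodule.map (colSpan M).subtype) e.span_eq
    rw [Submodule.map_span, ← Set.range_comp, Submodule.map_top, range_subtype] at h2
    rw [← h2]
    exact le_rfl
  obtain ⟨L, hL⟩ := exists_mul_eq_of_colSpan_le h
  have : colSpan Mᴴ ≤ colSpan Lᴴ := by
    have hL' := congrArg conjTranspose hL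
    rw [conjTranspose_mul] at hL'
    exact (congrArg colSpan hL').trans_le (colSpan_mul_le _ _)
  calc qrank Mᴴ ≤ qrank Lᴴ := finrank_mono this
    _ ≤ Fintype.card (Fin (qrank M)) := qrank_le_card _
    _ = qrank M := Fintype.card_fin _

theorem qrank_conjTranspose [Fintype k] (M : Matrix k l ℍ[ℝ]) : qrank Mᴴ = qrank M :=
  le_antisymm (qrank_conjTranspose_le M) (by simpa using qrank_conjTranspose_le Mᴴ)

/-- This turns ρ into the dimension of the triple intersection. A vector in the kernel of (D, 0, C)
satisfies Dz = -Cy, so (D, B, 0) maps this kernel onto col B + (col C ∩ col D); the dimension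
formula does the rest. -/
theorem qrank_fromRows_fromCols [Fintype k] (B : Matrix k l ℍ[ℝ]) (C : Matrix k l' ℍ[ℝ])
    (D : Matrix k l'' ℍ[ℝ]) :
    qrank (fromRows (fromCols D (fromCols B 0)) (fromCols D (fromCols (0 : Matrix k l ℍ[ℝ]) C))) +
      finrank (ℍ[ℝ])ᵐᵒᵖ (colSpan B ⊓ colSpan C ⊓ colSpan D : Submodule _ _) =
    qrank B + qrank C + qrank D := by
  have h : Submodule.map (mulVecRight (fromCols D (fromCols B 0)))
      (LinearMap.ker (mulVecRight (fromCols D (fromCols (0 : Matrix k l ℍ[ℝ]) C)))) =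
      colSpan B ⊔ (colSpan C ⊓ colSpan D) := by
    ext v
    simp only [Submodule.mem_map, LinearMap.mem_ker, mulVecRight_apply, fromCols_mulVec,
      zero_mulVec, add_zero, zero_add, mem_sup, mem_inf, mem_colSpan_iff]
    constructor
    · rintro ⟨x, hx, rfl⟩
      refine ⟨_, ⟨(x ∘ Sum.inr) ∘ Sum.inl, rfl⟩, D *ᵥ (x ∘ Sum.inl),
        ⟨⟨-((x ∘ Sum.inr) ∘ Sum.inr), ?_⟩, ⟨_, rfl⟩⟩, add_comm _ _⟩
      rw [mulVec_neg]
      exact (eq_neg_of_add_eq_zero_left hx).symm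
    · rintro ⟨_, ⟨x, rfl⟩, _, ⟨⟨y, rfl⟩, ⟨z, hz⟩⟩, rfl⟩
      refine ⟨Sum.elim z (Sum.elim x (-y)), ?_, ?_⟩
      · change D *ᵥ z + C *ᵥ (-y) = 0
        rw [mulVec_neg, hz, add_neg_cancel]
      · change D *ᵥ z + B *ᵥ x = _
        rw [hz, add_comm]
  rw [qrank_fromRows, h, qrank_fromCols, colSpan_fromCols]
  rw [colSpan_zero, bot_sup_eq]
  have h₁ := finrank_sup_add_finrank_inf_eq (colSpan D) (colSpan C)
  have h₂ := finrank_sup_add_finrank_inf_eq (colSpan B) (colSpan C ⊓ colSpan D)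
  rw [← inf_assoc] at h₂
  rw [inf_comm (colSpan D)] at h₁
  simp only [finrank_colSpan] at h₁ h₂ ⊢
  omega

/-- The source of t: with N = K, it is the dimension by which A(ker K) enlarges col W. The kernel of
(N, 0) is ker N times the whole second factor, and (A, W) maps it onto the sum on the right. -/
theorem qrank_fromBlocks_zero {k' : Type*} (A : Matrix k l ℍ[ℝ]) (W : Matrix k l' ℍ[ℝ])
    (N : Matrix k' l ℍ[ℝ]) :
    qrank (fromBlocks A W N 0) = qrank N + finrank (ℍ[ℝ])ᵐᵒᵖ
      (colSpan W ⊔ Submodule.map (mulVecRight A) (LinearMap.ker (mulVecRight N)) :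
        Submodule _ _) := by
  have h : Submodule.map (mulVecRight (fromCols A W))
      (LinearMap.ker (mulVecRight (fromCols N (0 : Matrix k' l' ℍ[ℝ])))) =
      colSpan W ⊔ Submodule.map (mulVecRight A) (LinearMap.ker (mulVecRight N)) := by
    ext v
    simp only [Submodule.mem_map, LinearMap.mem_ker, mulVecRight_apply, fromCols_mulVec,
      zero_mulVec, add_zero, mem_sup, mem_colSpan_iff]
    constructor
    · rintro ⟨x, hx, rfl⟩
      exact ⟨_, ⟨_, rfl⟩, _, ⟨_, hx, rfl⟩, add_comm _ _⟩
    · rintro ⟨_, ⟨x, rfl⟩, _, ⟨y, hy, rfl⟩, rfl⟩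
      exact ⟨Sum.elim y x, hy, add_comm _ _⟩
  rw [← fromRows_fromCols_eq_fromBlocks, qrank_fromRows, h, qrank_fromCols, colSpan_zero, sup_bot_eq,
    finrank_colSpan]

/-- Every map of right vector spaces between spaces of columns is given by a matrix. -/
theorem exists_mulVec_eq (f : (l → ℍ[ℝ]) →ₗ[(ℍ[ℝ])ᵐᵒᵖ] (k → ℍ[ℝ])) :
    ∃ M : Matrix k l ℍ[ℝ], ∀ x, f x = M *ᵥ x := by
  classical
  refine ⟨Matrix.of fun i j => f (Pi.single j 1) i, fun x => ?_⟩
  have hx : x = ∑ j, MulOpposite.op (x j) • (Pi.single j 1 : l → ℍ[ℝ]) := by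
    ext i : 1
    simp [Pi.single_apply]
  conv_lhs => rw [hx, map_sum]
  ext i : 1
  simp [mulVec, dotProduct]

/-- Two matrices with the same column space are right equivalent. -/
theorem exists_GL_mul_eq [DecidableEq l] {M N : Matrix k l ℍ[ℝ]} (h : colSpan M = colSpan N) :
    ∃ T : GL l ℍ[ℝ], M = N * T.val := by
  obtain ⟨T, hT⟩ := exists_linearEquiv_comp_eq (mulVecRight M) (mulVecRight N)
    (by rw [← colSpan_eq_range, ← colSpan_eq_range, h])
  obtain ⟨X, hX⟩ := exists_mulVec_eq T.toLinearMap
  obtain ⟨Y, hY⟩ := exists_mulVec_eq T.symm.toLinearMap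
  simp only [LinearEquiv.coe_coe] at hX hY
  refine ⟨⟨X, Y, ?_, ?_⟩, ?_⟩ <;> apply ext_of_mulVec_single <;> intro i
  · rw [← mulVec_mulVec, ← hY, ← hX, one_mulVec, T.apply_symm_apply]
  · rw [← mulVec_mulVec, ← hX, ← hY, one_mulVec, T.symm_apply_apply]
  · rw [← mulVec_mulVec, ← hX]; exact hT _

/-- A square matrix whose columns span is invertible. -/
theorem exists_GL_eq_of_colSpan_eq_top [DecidableEq l] {M : Matrix l l ℍ[ℝ]}
    (h : colSpan M = ⊤) : ∃ P : GL l ℍ[ℝ], P.val = M := by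
  obtain ⟨L, hL⟩ := exists_mul_eq_of_colSpan_le (M := M) (N := (1 : Matrix l l ℍ[ℝ]))
    (h.symm ▸ le_top)
  exact ⟨⟨M, L, hL.symm, mul_eq_one_comm.1 hL.symm⟩, rfl⟩

end MatrixRank

/-! ### Column spaces of products with tables of identity blocks -/

section BlockColumns

open Module Submodule

theorem iSup_fin_succ {α : Type*} [CompleteLattice α] {n : ℕ} (f : Fin (n + 1) → α) :
    ⨆ i, f i = f 0 ⊔ ⨆ i : Fin n, f i.succ :=
  le_antisymm
    (iSup_le fun i => Fin.cases le_sup_left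
      (fun i => (le_iSup (fun i : Fin n => f i.succ) i).trans le_sup_right) i)
    (sup_le (le_iSup f 0) (iSup_le fun i => le_iSup f i.succ))

theorem colSpan_sigma {k : Type*} {a : ℕ} {c : Fin a → ℕ}
    (M : Matrix k (Σ j, Fin (c j)) ℍ[ℝ]) :
    colSpan M = ⨆ j, span (ℍ[ℝ])ᵐᵒᵖ (Set.range fun y : Fin (c j) => M.col ⟨j, y⟩) := by
  rw [← span_iUnion, colSpan, Set.range_sigma_eq_iUnion_range]

theorem colSpan_submatrix_equiv {k l l' : Type*} (M : Matrix k l ℍ[ℝ]) (e : l' ≃ l) :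
    colSpan (M.submatrix id e) = colSpan M := by
  have : (M.submatrix id e).col = M.col ∘ e := rfl
  rw [colSpan, this, e.surjective.range_comp]

variable {k : Type*} {a b : ℕ} {r : Fin a → ℕ} {c : Fin b → ℕ}
  (M : Matrix k (Σ i, Fin (r i)) ℍ[ℝ]) {T : Matrix (Fin a) (Fin b) ℕ}

/-- No equality of the sizes `c j` and `r i` is assumed, so an identity block may be rectangular;
the inner condition discards the columns beyond its diagonal. -/
theorem mul_ofPattern_apply (x : k) (j : Fin b) (y : Fin (c j)) :
    (M * ofPattern T r c) x ⟨j, y⟩ = ∑ i, if T i j = 1 then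
      (if h : (y : ℕ) < r i then M x ⟨i, ⟨y, h⟩⟩ else 0) else 0 := by
  rw [mul_apply, Fintype.sum_sigma]
  refine Finset.sum_congr rfl fun i _ => ?_
  split_ifs with hT h
  · rw [Finset.sum_eq_single ⟨y, h⟩]
    · simp [ofPattern, hT, idBlock]
    · intro z _ hz
      have : (z : ℕ) ≠ y := fun hzy => hz (Fin.ext hzy)
      simp [ofPattern, hT, idBlock, this]
    · simp
  · refine Finset.sum_eq_zero fun z _ => ?_
    have : (z : ℕ) ≠ y := fun hzy => h (hzy ▸ z.2)
    simp [ofPattern, hT, idBlock, this]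
  · simp [ofPattern, hT]

theorem col_mul_ofPattern_single {j : Fin b} {i₀ : Fin a} (h : ∀ i, T i j = 1 ↔ i = i₀)
    (hs : c j = r i₀) (y : Fin (c j)) :
    (M * ofPattern T r c).col ⟨j, y⟩ = M.col ⟨i₀, Fin.cast hs y⟩ := by
  ext x : 1
  have hy : (y : ℕ) < r i₀ := hs ▸ y.2
  rw [col_apply, mul_ofPattern_apply]
  simp only [h, Finset.sum_ite_eq', Finset.mem_univ, if_true, dif_pos hy]
  rfl

/-- Needed for the one block column of `pattern₃` with two identity blocks, which produces the sums
`f₄ + f₄'`. -/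
theorem col_mul_ofPattern_pair {j : Fin b} {i₀ i₁ : Fin a} (hne : i₀ ≠ i₁)
    (h : ∀ i, T i j = 1 ↔ i = i₀ ∨ i = i₁) (hs : c j = r i₀) (hs' : c j = r i₁) (y : Fin (c j)) :
    (M * ofPattern T r c).col ⟨j, y⟩ =
      M.col ⟨i₀, Fin.cast hs y⟩ + M.col ⟨i₁, Fin.cast hs' y⟩ := by
  ext x : 1
  have hy : (y : ℕ) < r i₀ := hs ▸ y.2
  have hy' : (y : ℕ) < r i₁ := hs' ▸ y.2
  rw [col_apply, mul_ofPattern_apply, Fintype.sum_eq_add i₀ i₁ hne]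
  · rw [if_pos ((h _).2 (Or.inl rfl)), if_pos ((h _).2 (Or.inr rfl)), dif_pos hy, dif_pos hy']
    rfl
  · rintro i ⟨h₀, h₁⟩
    exact if_neg fun hT => ((h i).1 hT).elim h₀ h₁

theorem col_mul_ofPattern_zero {j : Fin b} (h : ∀ i, T i j ≠ 1) (y : Fin (c j)) :
    (M * ofPattern T r c).col ⟨j, y⟩ = 0 := by
  ext x : 1
  rw [col_apply, mul_ofPattern_apply]
  exact Finset.sum_eq_zero fun i _ => if_neg (h i)

/-- The span of the columns of a block column. -/
noncomputable abbrev blockSpan (i : Fin a) : Submodule (ℍ[ℝ])ᵐᵒᵖ (k → ℍ[ℝ]) :=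
  span (ℍ[ℝ])ᵐᵒᵖ (Set.range fun y : Fin (r i) => M.col ⟨i, y⟩)

theorem blockSpan_mul_ofPattern_single {j : Fin b} (i₀ : Fin a) (h : ∀ i, T i j = 1 ↔ i = i₀)
    (hs : c j = r i₀) : blockSpan (M * ofPattern T r c) j = blockSpan M i₀ := by
  simp only [blockSpan, col_mul_ofPattern_single M h hs]
  rw [← (finCongr hs).surjective.range_comp]
  rfl

theorem blockSpan_mul_ofPattern_pair {j : Fin b} {i₀ i₁ : Fin a} (hne : i₀ ≠ i₁)
    (h : ∀ i, T i j = 1 ↔ i = i₀ ∨ i = i₁) (hs : c j = r i₀) (hs' : c j = r i₁) :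
    blockSpan (M * ofPattern T r c) j = span (ℍ[ℝ])ᵐᵒᵖ (Set.range fun y : Fin (c j) =>
      M.col ⟨i₀, Fin.cast hs y⟩ + M.col ⟨i₁, Fin.cast hs' y⟩) := by
  simp only [blockSpan, col_mul_ofPattern_pair M hne h hs hs']

theorem blockSpan_mul_ofPattern_zero {j : Fin b} (h : ∀ i, T i j ≠ 1) :
    blockSpan (M * ofPattern T r c) j = ⊥ := by
  rw [span_eq_bot]
  rintro _ ⟨y, rfl⟩
  exact col_mul_ofPattern_zero M h y

theorem colSpan_eq_sup_six {c : Fin 6 → ℕ} (M : Matrix k (Σ j, Fin (c j)) ℍ[ℝ]) :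
    colSpan M = blockSpan M 0 ⊔ blockSpan M 1 ⊔ blockSpan M 2 ⊔ blockSpan M 3 ⊔ blockSpan M 4 ⊔
      blockSpan M 5 := by
  rw [colSpan_sigma]
  simp only [iSup_fin_succ, iSup_of_empty, sup_bot_eq]
  simp only [sup_assoc]
  rfl

variable {s₁ s₂ s₃ s₄ s₅ s₆ s₇ s₈ s₀ t : ℕ}
  (N : Matrix k (Σ i, Fin (sizes s₁ s₂ s₃ s₄ s₅ s₆ s₇ s₈ s₀ t i)) ℍ[ℝ])

theorem colSpan_mul_pattern₁ (b₀ : ℕ) :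
    colSpan (N * ofPattern pattern₁
      (sizes s₁ s₂ s₃ s₄ s₅ s₆ s₇ s₈ s₀ t) ![s₁, s₂, s₃, s₄, s₅, b₀]) =
      blockSpan N 0 ⊔ blockSpan N 1 ⊔ blockSpan N 2 ⊔ blockSpan N 3 ⊔ blockSpan N 4 := by
  rw [colSpan_eq_sup_six,
    blockSpan_mul_ofPattern_single N (c := ![s₁, s₂, s₃, s₄, s₅, b₀]) (j := 0) 0 (by decide) rfl,
    blockSpan_mul_ofPattern_single N (c := ![s₁, s₂, s₃, s₄, s₅, b₀]) (j := 1) 1 (by decide) rfl,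
    blockSpan_mul_ofPattern_single N (c := ![s₁, s₂, s₃, s₄, s₅, b₀]) (j := 2) 2 (by decide) rfl,
    blockSpan_mul_ofPattern_single N (c := ![s₁, s₂, s₃, s₄, s₅, b₀]) (j := 3) 3 (by decide) rfl,
    blockSpan_mul_ofPattern_single N (c := ![s₁, s₂, s₃, s₄, s₅, b₀]) (j := 4) 4 (by decide) rfl,
    blockSpan_mul_ofPattern_zero N (j := 5) (by decide), sup_bot_eq]

theorem colSpan_mul_pattern₂ (c₀ : ℕ) :
    colSpan (N * ofPattern pattern₂
      (sizes s₁ s₂ s₃ s₄ s₅ s₆ s₇ s₈ s₀ t) ![s₄, s₆, s₇, s₁, s₂, c₀]) =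
      blockSpan N 5 ⊔ blockSpan N 6 ⊔ blockSpan N 7 ⊔ blockSpan N 0 ⊔ blockSpan N 1 := by
  rw [colSpan_eq_sup_six,
    blockSpan_mul_ofPattern_single N (j := 0) 5 (by decide) rfl,
    blockSpan_mul_ofPattern_single N (j := 1) 6 (by decide) rfl,
    blockSpan_mul_ofPattern_single N (j := 2) 7 (by decide) rfl,
    blockSpan_mul_ofPattern_single N (j := 3) 0 (by decide) rfl,
    blockSpan_mul_ofPattern_single N (j := 4) 1 (by decide) rfl,
    blockSpan_mul_ofPattern_zero N (j := 5) (by decide), sup_bot_eq]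

theorem colSpan_mul_pattern₃ (d₀ : ℕ) :
    colSpan (N * ofPattern pattern₃
      (sizes s₁ s₂ s₃ s₄ s₅ s₆ s₇ s₈ s₀ t) ![s₈, s₄, s₆, s₃, s₁, d₀]) =
      blockSpan N 8 ⊔ span (ℍ[ℝ])ᵐᵒᵖ (Set.range fun y : Fin s₄ =>
        N.col ⟨3, y⟩ + N.col ⟨5, y⟩) ⊔ blockSpan N 6 ⊔ blockSpan N 2 ⊔ blockSpan N 0 := by
  rw [colSpan_eq_sup_six,
    blockSpan_mul_ofPattern_single N (j := 0) 8 (by decide) rfl,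
    blockSpan_mul_ofPattern_pair N (j := 1) (i₀ := 3) (i₁ := 5) (by decide) (by decide) rfl rfl,
    blockSpan_mul_ofPattern_single N (j := 2) 6 (by decide) rfl,
    blockSpan_mul_ofPattern_single N (j := 3) 2 (by decide) rfl,
    blockSpan_mul_ofPattern_single N (j := 4) 0 (by decide) rfl,
    blockSpan_mul_ofPattern_zero N (j := 5) (by decide), sup_bot_eq]
  rfl

end BlockColumns

/-! ### Normal form of three matrices with the same number of rows -/

section NormalForm

open Module Submodule

/-- The matrix with the prescribed eleven block columns. -/
def blockColumns {k : Type*} {s₁ s₂ s₃ s₄ s₅ s₆ s₇ s₈ s₀ t : ℕ}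
    (f₁ : Fin s₁ → k → ℍ[ℝ]) (f₂ : Fin s₂ → k → ℍ[ℝ]) (f₃ : Fin s₃ → k → ℍ[ℝ])
    (f₄ : Fin s₄ → k → ℍ[ℝ]) (f₅ : Fin s₅ → k → ℍ[ℝ]) (f₄' : Fin s₄ → k → ℍ[ℝ])
    (f₆ : Fin s₆ → k → ℍ[ℝ]) (f₇ : Fin s₇ → k → ℍ[ℝ]) (f₈ : Fin s₈ → k → ℍ[ℝ])
    (f₀ : Fin s₀ → k → ℍ[ℝ]) (g : Fin t → k → ℍ[ℝ]) :
    Matrix k (Σ i, Fin (sizes s₁ s₂ s₃ s₄ s₅ s₆ s₇ s₈ s₀ t i)) ℍ[ℝ] :=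
  Matrix.of fun x y => match y with
    | ⟨0, z⟩ => f₁ z x
    | ⟨1, z⟩ => f₂ z x
    | ⟨2, z⟩ => f₃ z x
    | ⟨3, z⟩ => f₄ z x
    | ⟨4, z⟩ => f₅ z x
    | ⟨5, z⟩ => f₄' z x
    | ⟨6, z⟩ => f₆ z x
    | ⟨7, z⟩ => f₇ z x
    | ⟨8, z⟩ => f₈ z x
    | ⟨9, z⟩ => f₀ z x
    | ⟨10, z⟩ => g z x

/-- The normal form of three matrices with the same number of rows, with the columns of the
transformation matrix outside the sum of the column spaces prescribed. -/
theorem exists_triple_normal_form {m p₁ p₂ p₃ : ℕ}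
    (B : Matrix (Fin m) (Fin p₁) ℍ[ℝ]) (C : Matrix (Fin m) (Fin p₂) ℍ[ℝ])
    (D : Matrix (Fin m) (Fin p₃) ℍ[ℝ]) {m₁ m₂ m₃ m₄ m₅ m₆ m₇ m₈ m₀ t b₀ c₀ d₀ : ℕ}
    (hm : ∑ i, sizes m₁ m₂ m₃ m₄ m₅ m₆ m₇ m₈ m₀ t i = m)
    (hB : ∑ j, ![m₁, m₂, m₃, m₄, m₅, b₀] j = p₁)
    (hC : ∑ j, ![m₄, m₆, m₇, m₁, m₂, c₀] j = p₂)
    (hD : ∑ j, ![m₈, m₄, m₆, m₃, m₁, d₀] j = p₃)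
    (f₁ : Fin m₁ → Fin m → ℍ[ℝ]) (f₂ : Fin m₂ → Fin m → ℍ[ℝ]) (f₃ : Fin m₃ → Fin m → ℍ[ℝ])
    (f₄ : Fin m₄ → Fin m → ℍ[ℝ]) (f₅ : Fin m₅ → Fin m → ℍ[ℝ]) (f₄' : Fin m₄ → Fin m → ℍ[ℝ])
    (f₆ : Fin m₆ → Fin m → ℍ[ℝ]) (f₇ : Fin m₇ → Fin m → ℍ[ℝ]) (f₈ : Fin m₈ → Fin m → ℍ[ℝ])
    (f₀ : Fin m₀ → Fin m → ℍ[ℝ]) (g : Fin t → Fin m → ℍ[ℝ])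
    (sB : colSpan B = span _ (Set.range f₁) ⊔ span _ (Set.range f₂) ⊔ span _ (Set.range f₃) ⊔
      span _ (Set.range f₄) ⊔ span _ (Set.range f₅))
    (sC : colSpan C = span _ (Set.range f₁) ⊔ span _ (Set.range f₂) ⊔ span _ (Set.range f₆) ⊔
      span _ (Set.range f₄') ⊔ span _ (Set.range f₇))
    (sD : colSpan D = span _ (Set.range f₁) ⊔ span _ (Set.range f₃) ⊔ span _ (Set.range f₆) ⊔
      span _ (Set.range (f₄ + f₄')) ⊔ span _ (Set.range f₈))
    (htop : colSpan B ⊔ (colSpan C ⊔ colSpan D) ⊔ span _ (Set.range f₀) ⊔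
      span _ (Set.range g) = ⊤) :
    ∃ (P : GL (Fin m) ℍ[ℝ]) (T₁ : GL (Fin p₁) ℍ[ℝ]) (T₂ : GL (Fin p₂) ℍ[ℝ])
      (T₃ : GL (Fin p₃) ℍ[ℝ]),
      B = P.val * reindex (blockEquiv _ hm) (blockEquiv _ hB) (ofPattern pattern₁ _ _) * T₁.val ∧
      C = P.val * reindex (blockEquiv _ hm) (blockEquiv _ hC) (ofPattern pattern₂ _ _) * T₂.val ∧
      D = P.val * reindex (blockEquiv _ hm) (blockEquiv _ hD) (ofPattern pattern₃ _ _) * T₃.val ∧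
      (∀ x, P.val.col (blockEquiv _ hm ⟨10, x⟩) = g x) ∧
      ∀ i, i ≠ 10 → ∀ x, P.val.col (blockEquiv _ hm ⟨i, x⟩) ∈
        colSpan B ⊔ (colSpan C ⊔ colSpan D) ⊔ span _ (Set.range f₀) := by
  let N := blockColumns f₁ f₂ f₃ f₄ f₅ f₄' f₆ f₇ f₈ f₀ g
  have hN : colSpan N = ⊤ := by
    rw [eq_top_iff, ← htop, sB, sC, sD]
    have h : ∀ i, blockSpan N i ≤ colSpan N := fun i => by
      rw [colSpan_sigma]; exact le_iSup (fun i => blockSpan N i) i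
    have h₄ : span (ℍ[ℝ])ᵐᵒᵖ (Set.range (f₄ + f₄')) ≤ colSpan N := span_range_le_iff.2 fun i =>
      add_mem (h 3 (subset_span ⟨i, rfl⟩)) (h 5 (subset_span ⟨i, rfl⟩))
    simp only [sup_le_iff]
    exact ⟨⟨⟨⟨⟨⟨⟨h 0, h 1⟩, h 2⟩, h 3⟩, h 4⟩, ⟨⟨⟨⟨h 0, h 1⟩, h 6⟩, h 5⟩, h 7⟩,
      ⟨⟨⟨h 0, h 2⟩, h 6⟩, h₄⟩, h 8⟩, h 9⟩, h 10⟩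
  -- By `hm` the matrix `N` has exactly m columns, so spanning suffices for invertibility.
  obtain ⟨P, hP⟩ := exists_GL_eq_of_colSpan_eq_top
    ((colSpan_submatrix_equiv N (blockEquiv _ hm).symm).trans hN)
  have hmul : ∀ {p : ℕ} {c : Fin 6 → ℕ} (hc : ∑ j, c j = p) (S : Matrix _ (Σ j, Fin (c j)) ℍ[ℝ]),
      colSpan (P.val * reindex (blockEquiv _ hm) (blockEquiv _ hc) S) = colSpan (N * S) := by
    intro p c hc S
    rw [hP, reindex_apply, submatrix_mul_equiv, colSpan_submatrix_equiv]
  obtain ⟨T₁, hT₁⟩ := exists_GL_mul_eq (M := B)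
    (N := P.val * reindex (blockEquiv _ hm) (blockEquiv _ hB) (ofPattern pattern₁ _ _)) (by
      rw [hmul, colSpan_mul_pattern₁, sB]; rfl)
  obtain ⟨T₂, hT₂⟩ := exists_GL_mul_eq (M := C)
    (N := P.val * reindex (blockEquiv _ hm) (blockEquiv _ hC) (ofPattern pattern₂ _ _)) (by
      rw [hmul, colSpan_mul_pattern₂, sC]
      change _ = span _ (Set.range f₄') ⊔ span _ (Set.range f₆) ⊔ span _ (Set.range f₇) ⊔
        span _ (Set.range f₁) ⊔ span _ (Set.range f₂)
      ac_rfl)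
  obtain ⟨T₃, hT₃⟩ := exists_GL_mul_eq (M := D)
    (N := P.val * reindex (blockEquiv _ hm) (blockEquiv _ hD) (ofPattern pattern₃ _ _)) (by
      rw [hmul, colSpan_mul_pattern₃, sD]
      change _ = span _ (Set.range f₈) ⊔ span _ (Set.range (f₄ + f₄')) ⊔ span _ (Set.range f₆) ⊔
        span _ (Set.range f₃) ⊔ span _ (Set.range f₁)
      ac_rfl)
  have hcol : ∀ i x, P.val.col (blockEquiv _ hm ⟨i, x⟩) = N.col ⟨i, x⟩ := fun i x => by
    rw [hP]
    ext y : 1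
    simp only [col_apply, submatrix_apply, Equiv.symm_apply_apply, id]
  have lB : colSpan B ≤ colSpan B ⊔ (colSpan C ⊔ colSpan D) ⊔ span _ (Set.range f₀) :=
    le_sup_left.trans le_sup_left
  have lC : colSpan C ≤ colSpan B ⊔ (colSpan C ⊔ colSpan D) ⊔ span _ (Set.range f₀) :=
    le_sup_left.trans (le_sup_right.trans le_sup_left)
  have lD : colSpan D ≤ colSpan B ⊔ (colSpan C ⊔ colSpan D) ⊔ span _ (Set.range f₀) :=
    le_sup_right.trans (le_sup_right.trans le_sup_left)
  refine ⟨P, T₁, T₂, T₃, hT₁, hT₂, hT₃, fun x => hcol 10 x, fun i hi x => ?_⟩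
  rw [hcol]
  -- Only the left-hand column space is expanded, so that the inclusion splits into one membership
  -- for each family.
  nth_rw 1 [sB] at lB
  nth_rw 1 [sC] at lC
  nth_rw 1 [sD] at lD
  simp only [sup_le_iff, span_range_le_iff] at lB lC lD
  obtain ⟨⟨⟨⟨l₁, l₂⟩, l₃⟩, l₄⟩, l₅⟩ := lB
  obtain ⟨⟨⟨-, l₆⟩, l₄'⟩, l₇⟩ := lC
  obtain ⟨-, l₈⟩ := lD
  match i, hi, x with
  | 0, _, x => exact l₁ x
  | 1, _, x => exact l₂ x
  | 2, _, x => exact l₃ x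
  | 3, _, x => exact l₄ x
  | 4, _, x => exact l₅ x
  | 5, _, x => exact l₄' x
  | 6, _, x => exact l₆ x
  | 7, _, x => exact l₇ x
  | 8, _, x => exact l₈ x
  | 9, _, x =>
    exact (le_sup_right : span _ (Set.range f₀) ≤ colSpan B ⊔ (colSpan C ⊔ colSpan D) ⊔ _)
      (subset_span ⟨x, rfl⟩)
  | 10, hi, _ => exact absurd rfl hi

end NormalForm

/-! ### Tools for the passage to rows and for the choice of the last blocks -/

section Simultaneous

open Module Submodule

/-- A vector completing U inside U + f(N) may be changed modulo U into one of the form f(u) with u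
in N. -/
theorem exists_mem_sup_span_range_eq {K V W : Type*} [DivisionRing K] [AddCommGroup V]
    [Module K V] [AddCommGroup W] [Module K W] [FiniteDimensional K W] (f : V →ₗ[K] W)
    (U : Submodule K W) (N : Submodule K V) {k : ℕ}
    (hk : finrank K U + k = finrank K (U ⊔ N.map f : Submodule K W)) :
    ∃ u : Fin k → V, (∀ i, u i ∈ N) ∧ U ⊔ span K (Set.range fun i => f (u i)) = U ⊔ N.map f := by
  obtain ⟨g, hg⟩ := exists_sup_span_range_eq le_sup_left hk
  have h : ∀ i, ∃ u ∈ N, ∃ w ∈ U, w + f u = g i := fun i => by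
    obtain ⟨w, hw, _, ⟨u, hu, rfl⟩, h⟩ :=
      mem_sup.1 (hg.le (le_sup_right (a := U) (subset_span ⟨i, rfl⟩)))
    exact ⟨u, hu, w, hw, h⟩
  choose u hu w hw h using h
  refine ⟨u, hu, le_antisymm ?_ ?_⟩
  · exact sup_le_sup_left (span_range_le_iff.2 fun i => mem_map_of_mem (hu i)) _
  · rw [← hg]
    refine sup_le le_sup_left (span_range_le_iff.2 fun i => ?_)
    rw [← h]
    exact add_mem_sup (hw i) (subset_span ⟨i, rfl⟩)

theorem qrank_fromRows_eq {l l' n : Type*} [Fintype l] [Fintype l'] [Fintype n]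
    (E : Matrix l n ℍ[ℝ]) (F : Matrix l' n ℍ[ℝ]) :
    qrank (fromRows E F) = qrank (fromCols Eᴴ Fᴴ) := by
  rw [← qrank_conjTranspose, conjTranspose_fromRows_eq_fromCols_conjTranspose]

/-- σ is ρ for the triple Eᴴ, Fᴴ, Gᴴ, so the results on columns apply to rows. -/
theorem qrank_fromRows_zero_eq {l l' l'' n : Type*} [Fintype l] [Fintype l'] [Fintype l'']
    [Fintype n] (E : Matrix l n ℍ[ℝ]) (F : Matrix l' n ℍ[ℝ]) (G : Matrix l'' n ℍ[ℝ]) :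
    qrank (fromRows (fromCols G G) (fromRows (fromCols E 0) (fromCols (0 : Matrix l' n ℍ[ℝ]) F))) =
      qrank (fromRows (fromCols Gᴴ (fromCols Eᴴ 0))
        (fromCols Gᴴ (fromCols (0 : Matrix n l ℍ[ℝ]) Fᴴ))) := by
  rw [← qrank_conjTranspose]
  congr 1
  refine Matrix.ext fun i j => ?_
  rcases i with i | i <;> rcases j with j | j | j <;> simp [conjTranspose_apply]

/-- Every row of a table of identity blocks without an entry `1` is a zero block row. -/
theorem reindex_ofPattern_apply_eq_zero {a b M N : ℕ} {T : Matrix (Fin a) (Fin b) ℕ}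
    {r : Fin a → ℕ} {c : Fin b → ℕ} (hr : ∑ i, r i = M) (hc : ∑ j, c j = N) {i : Fin a}
    (h : ∀ j, T i j ≠ 1) (x : Fin (r i)) (y : Fin N) :
    reindex (blockEquiv r hr) (blockEquiv c hc) (ofPattern T r c) (blockEquiv r hr ⟨i, x⟩) y =
      0 := by
  simp [ofPattern, h]

theorem colSpan_le_ker {k l l' : Type*} [Fintype l] [Fintype l'] {M : Matrix k l ℍ[ℝ]}
    {N : Matrix l l' ℍ[ℝ]} (h : M * N = 0) : colSpan N ≤ LinearMap.ker (mulVecRight M) := by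
  intro v hv
  obtain ⟨x, rfl⟩ := mem_colSpan_iff.1 hv
  rw [LinearMap.mem_ker, mulVecRight_apply, mulVec_mulVec, h, zero_mulVec]

theorem conjTranspose_normal_form {q n : ℕ} {E : Matrix (Fin q) (Fin n) ℍ[ℝ]}
    {Q : GL (Fin n) ℍ[ℝ]} {V : GL (Fin q) ℍ[ℝ]} {a b : Type*} (e : a ≃ Fin n) (e' : b ≃ Fin q)
    {S : Matrix a b ℍ[ℝ]} (h : Eᴴ = Q.val * reindex e e' S * V.val) :
    E = (star V).val * reindex e' e Sᴴ * (star Q).val := by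
  rw [← conjTranspose_conjTranspose E, h, conjTranspose_mul, conjTranspose_mul, ← Matrix.mul_assoc,
    conjTranspose_reindex]
  rfl

/-- If the columns of `R` are dual to those of `U`, then the vectors orthogonal to the columns
of `U` have the expected dimension and span everything together with the columns of `R`. -/
theorem finrank_ker_conjTranspose {n t : ℕ} {U R : Matrix (Fin n) (Fin t) ℍ[ℝ]}
    (h : Uᴴ * R = 1) :
    finrank (ℍ[ℝ])ᵐᵒᵖ (LinearMap.ker (mulVecRight Uᴴ)) + t = n ∧
      LinearMap.ker (mulVecRight Uᴴ) ⊔ colSpan R = ⊤ := by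
  constructor
  · have h₁ := qrank_add_finrank_ker Uᴴ
    have h₂ : colSpan Uᴴ = ⊤ := by
      refine eq_top_iff.2 fun v _ => mem_colSpan_iff.2 ⟨R *ᵥ v, ?_⟩
      rw [mulVec_mulVec, h, one_mulVec]
    rw [← finrank_colSpan, h₂, finrank_top, finrank_op_pi, Fintype.card_fin, Fintype.card_fin] at h₁
    omega
  · refine eq_top_iff.2 fun v _ => ?_
    rw [← sub_add_cancel v (R *ᵥ (Uᴴ *ᵥ v))]
    refine add_mem_sup ?_ (mulVec_mem_colSpan _ _)
    rw [LinearMap.mem_ker, mulVecRight_apply, mulVec_sub, mulVec_mulVec (M := Uᴴ) (N := R), h,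
      one_mulVec, sub_self]

end Simultaneous

/-! ### The block form of A in adapted bases -/

section TrailingForm

theorem sum_sizes (s₁ s₂ s₃ s₄ s₅ s₆ s₇ s₈ s₀ t : ℕ) :
    ∑ i, sizes s₁ s₂ s₃ s₄ s₅ s₆ s₇ s₈ s₀ t i =
      s₁ + s₂ + s₃ + s₄ + s₅ + s₄ + s₆ + s₇ + s₈ + s₀ + t := by
  simp [sizes, Fin.sum_univ_succ]
  omega

theorem sum_six (a b c d e f : ℕ) : ∑ i, ![a, b, c, d, e, f] i = a + b + c + d + e + f := by
  simp [Fin.sum_univ_succ]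
  omega

theorem blockEquiv_ne {a N : ℕ} {r : Fin a → ℕ} (h : ∑ i, r i = N) {i j : Fin a} (hij : i ≠ j)
    (x : Fin (r i)) (y : Fin (r j)) : blockEquiv r h ⟨i, x⟩ ≠ blockEquiv r h ⟨j, y⟩ :=
  fun he => hij (congrArg Sigma.fst ((blockEquiv r h).injective he))

theorem blockEquiv_inj_iff {a N : ℕ} {r : Fin a → ℕ} (h : ∑ i, r i = N) {i : Fin a}
    (x y : Fin (r i)) : blockEquiv r h ⟨i, x⟩ = blockEquiv r h ⟨i, y⟩ ↔ x = y :=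
  ⟨fun he => eq_of_heq (Sigma.mk.inj ((blockEquiv r h).injective he)).2, fun he => he ▸ rfl⟩

/-- The rows of `P⁻¹` in a block row where `T` vanishes annihilate `P * S * Y` if `S` has the
pattern `T`. -/
theorem inv_submatrix_mul_eq_zero {M N a b : ℕ} {r : Fin a → ℕ} {c : Fin b → ℕ}
    (hr : ∑ i, r i = M) (hc : ∑ j, c j = N) {T : Matrix (Fin a) (Fin b) ℕ} (P : GL (Fin M) ℍ[ℝ])
    {X : Matrix (Fin M) (Fin N) ℍ[ℝ]} {Y : Matrix (Fin N) (Fin N) ℍ[ℝ]}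
    (hX : X = P.val * reindex (blockEquiv r hr) (blockEquiv c hc) (ofPattern T r c) * Y)
    {i : Fin a} (hT : ∀ j, T i j ≠ 1) :
    P⁻¹.val.submatrix (fun y => blockEquiv r hr ⟨i, y⟩) id * X = 0 := by
  refine Matrix.ext fun y j => ?_
  have h : (P⁻¹.val.submatrix (fun y => blockEquiv r hr ⟨i, y⟩) id * X) y j =
      (P⁻¹.val * X) (blockEquiv r hr ⟨i, y⟩) j := rfl
  rw [h, hX, Matrix.mul_assoc, ← Matrix.mul_assoc, P.inv_mul, Matrix.one_mul, mul_apply]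
  exact Finset.sum_eq_zero fun z _ => by
    rw [reindex_ofPattern_apply_eq_zero hr hc hT, zero_mul]

/-- The columns of `Q⁻¹` in a block column where `T` vanishes are annihilated by `Y * Sᴴ * Q` if
`S` has the pattern `T`. -/
theorem mulVec_inv_single_eq_zero {M N a b : ℕ} {r : Fin a → ℕ} {c : Fin b → ℕ}
    (hr : ∑ i, r i = M) (hc : ∑ j, c j = N) {T : Matrix (Fin a) (Fin b) ℕ} (Q : GL (Fin M) ℍ[ℝ])
    {X : Matrix (Fin N) (Fin M) ℍ[ℝ]} {Y : Matrix (Fin N) (Fin N) ℍ[ℝ]}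
    (hX : X = Y * reindex (blockEquiv c hc) (blockEquiv r hr) (ofPattern T r c)ᴴ * Q.val)
    {i : Fin a} (hT : ∀ j, T i j ≠ 1) (y : Fin (r i)) :
    X *ᵥ (Q⁻¹.val *ᵥ Pi.single (blockEquiv r hr ⟨i, y⟩) 1) = 0 := by
  have h₀ : reindex (blockEquiv c hc) (blockEquiv r hr) (ofPattern T r c)ᴴ *ᵥ
      Pi.single (blockEquiv r hr ⟨i, y⟩) 1 = 0 := by
    rw [mulVec_single_one, ← conjTranspose_reindex]
    funext z
    rw [col_apply, conjTranspose_apply, reindex_ofPattern_apply_eq_zero hr hc hT, star_zero]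
    rfl
  rw [mulVec_mulVec, hX, Matrix.mul_assoc, Q.mul_inv, Matrix.mul_one, ← mulVec_mulVec,
    h₀, mulVec_zero]

/-- If block `i₀` of the columns of `Q` is dual to the columns of `U` and the other columns of `Q`
are orthogonal to them, then `Qᴴ` maps the columns of `U` to standard basis vectors. -/
theorem star_mulVec_eq_single {N a t : ℕ} {r : Fin a → ℕ} (hr : ∑ i, r i = N)
    (Q : GL (Fin N) ℍ[ℝ]) {U R : Matrix (Fin N) (Fin t) ℍ[ℝ]} (hU : Uᴴ * R = 1) {i₀ : Fin a}
    (h₀ : r i₀ = t) (hQR : ∀ x, Q.val.col (blockEquiv r hr ⟨i₀, x⟩) = R.col (Fin.cast h₀ x))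
    (hQ : ∀ i, i ≠ i₀ → ∀ y, Q.val.col (blockEquiv r hr ⟨i, y⟩) ∈
      LinearMap.ker (mulVecRight Uᴴ)) (x : Fin (r i₀)) :
    (star Q).val *ᵥ U.col (Fin.cast h₀ x) = Pi.single (blockEquiv r hr ⟨i₀, x⟩) 1 := by
  funext z
  have key : ((star Q).val *ᵥ U.col (Fin.cast h₀ x)) z =
      star ((Uᴴ *ᵥ Q.val.col z) (Fin.cast h₀ x)) := by
    simp [mulVec, dotProduct, conjTranspose_apply]
  rw [key]
  obtain ⟨⟨i, y⟩, rfl⟩ := (blockEquiv r hr).surjective z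
  by_cases hi : i = i₀
  · subst hi
    have h : (Uᴴ *ᵥ R.col (Fin.cast h₀ y)) (Fin.cast h₀ x) =
      (Uᴴ * R) (Fin.cast h₀ x) (Fin.cast h₀ y) := rfl
    rw [hQR, h, hU, one_apply, Pi.single_apply, apply_ite star, star_one, star_zero]
    exact if_congr (by rw [blockEquiv_inj_iff, Fin.cast_inj, eq_comm]) rfl rfl
  · rw [← mulVecRight_apply, LinearMap.mem_ker.1 (hQ i hi y), Pi.single_apply,
      if_neg (blockEquiv_ne hr hi _ _), Pi.zero_apply, star_zero]

theorem isTrailingForm_submatrix {m n : ℕ} {r c : Fin 11 → ℕ} (hm : ∑ i, r i = m)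
    (hn : ∑ j, c j = n) {Z : Matrix (Fin m) (Fin n) ℍ[ℝ]} (h : r 10 = c 10)
    (hr : ∀ x j, Z (blockEquiv _ hm ⟨10, x⟩) j =
      (1 : Matrix (Fin n) (Fin n) ℍ[ℝ]) (blockEquiv _ hn ⟨10, Fin.cast h x⟩) j)
    (hc : ∀ i x, Z i (blockEquiv _ hn ⟨10, x⟩) =
      (Pi.single (blockEquiv _ hm ⟨10, Fin.cast h.symm x⟩) 1 : Fin m → ℍ[ℝ]) i)
    (h₀ : ∀ x y, Z (blockEquiv _ hm ⟨9, x⟩) (blockEquiv _ hn ⟨9, y⟩) = 0) :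
    IsTrailingForm (Z.submatrix (blockEquiv _ hm) (blockEquiv _ hn)) := by
  refine ⟨fun i hi => Matrix.ext fun x y => (hc _ _).trans ?_,
    fun j hj => Matrix.ext fun x y => (hr _ _).trans ?_, Matrix.ext fun x y => h₀ x y,
    Matrix.ext fun x y => (hr _ _).trans ?_⟩
  · exact Pi.single_eq_of_ne (blockEquiv_ne hm hi _ _) _
  · exact one_apply_ne (blockEquiv_ne hn (Ne.symm hj) _ _)
  · rw [one_apply, idBlock, of_apply]
    exact if_congr ((blockEquiv_inj_iff hn _ _).trans Fin.ext_iff) rfl rfl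

theorem inv_mulVec_col {k : Type*} [Fintype k] [DecidableEq k] (P : GL k ℍ[ℝ]) (j : k) :
    P⁻¹.val *ᵥ P.val.col j = Pi.single j 1 := by
  rw [← mulVec_single_one, mulVec_mulVec, P.inv_mul, one_mulVec]

theorem inv_submatrix_mulVec_col {N a : ℕ} {r : Fin a → ℕ} (hr : ∑ i, r i = N)
    (P : GL (Fin N) ℍ[ℝ]) {i j : Fin a} (hij : i ≠ j) (x : Fin (r j)) :
    P⁻¹.val.submatrix (fun y => blockEquiv r hr ⟨i, y⟩) id *ᵥ
      P.val.col (blockEquiv r hr ⟨j, x⟩) = 0 := by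
  funext y
  exact (congrFun (inv_mulVec_col P _) _).trans
    (Pi.single_eq_of_ne (blockEquiv_ne hr hij _ _) _)

/-- If the columns of `A U` are a block of columns of `P`, then the conjugate transposes of the
corresponding rows of `P⁻¹ A` are dual to the columns of `U`. -/
theorem exists_conjTranspose_mul_eq_one {m n a t : ℕ} {r : Fin a → ℕ} (hm : ∑ i, r i = m)
    (A : Matrix (Fin m) (Fin n) ℍ[ℝ]) (P : GL (Fin m) ℍ[ℝ]) {U : Matrix (Fin n) (Fin t) ℍ[ℝ]}
    {i : Fin a} (h : r i = t)
    (hP : ∀ x, P.val.col (blockEquiv r hm ⟨i, x⟩) = A *ᵥ U.col (Fin.cast h x)) :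
    ∃ R : Matrix (Fin n) (Fin t) ℍ[ℝ], Uᴴ * R = 1 ∧
      ∀ x j, star (R j (Fin.cast h x)) = (P⁻¹.val * A) (blockEquiv r hm ⟨i, x⟩) j := by
  subst h
  refine ⟨((P⁻¹.val * A).submatrix (fun x => blockEquiv r hm ⟨i, x⟩) id)ᴴ, ?_,
    fun x j => star_star _⟩
  rw [← conjTranspose_mul, conjTranspose_eq_one]
  refine Matrix.ext fun x y => ?_
  have h₁ : ((P⁻¹.val * A).submatrix (fun x => blockEquiv r hm ⟨i, x⟩) id * U) x y =
      ((P⁻¹.val * A) *ᵥ U.col y) (blockEquiv r hm ⟨i, x⟩) := rfl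
  have h₂ := hP y
  rw [Fin.cast_eq_self] at h₂
  rw [h₁, ← mulVec_mulVec, ← h₂, inv_mulVec_col, Pi.single_apply, one_apply]
  exact if_congr (blockEquiv_inj_iff hm _ _) rfl rfl

/-- The block form of `P⁻¹ A Q⁻ᴴ`, if the last blocks of columns of `P` and `Q` are adapted
to `A`. -/
theorem exists_isTrailingForm {m n t : ℕ} {r c : Fin 11 → ℕ} (hm : ∑ i, r i = m)
    (hn : ∑ j, c j = n) (A : Matrix (Fin m) (Fin n) ℍ[ℝ]) (P : GL (Fin m) ℍ[ℝ])
    (Q : GL (Fin n) ℍ[ℝ]) {U R : Matrix (Fin n) (Fin t) ℍ[ℝ]} (h : r 10 = t) (h' : c 10 = t)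
    (hP : ∀ x, P.val.col (blockEquiv r hm ⟨10, x⟩) = A *ᵥ U.col (Fin.cast h x))
    (hUR : Uᴴ * R = 1)
    (hR : ∀ x j, star (R j (Fin.cast h x)) = (P⁻¹.val * A) (blockEquiv r hm ⟨10, x⟩) j)
    (hQR : ∀ x, Q.val.col (blockEquiv c hn ⟨10, x⟩) = R.col (Fin.cast h' x))
    (hQ : ∀ i, i ≠ 10 → ∀ y, Q.val.col (blockEquiv c hn ⟨i, y⟩) ∈
      LinearMap.ker (mulVecRight Uᴴ))
    (h₀ : ∀ y, P⁻¹.val.submatrix (fun x => blockEquiv r hm ⟨9, x⟩) id *ᵥ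
      (A *ᵥ ((star Q)⁻¹.val *ᵥ Pi.single (blockEquiv c hn ⟨9, y⟩) 1)) = 0) :
    ∃ S : Matrix (Σ i, Fin (r i)) (Σ j, Fin (c j)) ℍ[ℝ], IsTrailingForm S ∧
      A = P.val * reindex (blockEquiv r hm) (blockEquiv c hn) S * (star Q).val := by
  have hcol : ∀ i j, (P⁻¹.val * A * (star Q)⁻¹.val) i j =
      (P⁻¹.val *ᵥ (A *ᵥ ((star Q)⁻¹.val *ᵥ Pi.single j 1))) i := fun i j => by
    rw [mulVec_mulVec, mulVec_mulVec, mulVec_single_one, col_apply]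
  refine ⟨(P⁻¹.val * A * (star Q)⁻¹.val).submatrix (blockEquiv r hm) (blockEquiv c hn),
    isTrailingForm_submatrix hm hn (h.trans h'.symm) (fun x j => ?_) (fun i x => ?_)
      (fun x y => ?_), ?_⟩
  -- The last rows of P⁻¹A are those of Rᴴ, which are also the last rows of Qᴴ. Multiplying by Q⁻ᴴ
  -- turns them into rows of the identity.
  · rw [← (star Q).mul_inv, mul_apply, mul_apply]
    refine Finset.sum_congr rfl fun z _ => ?_
    rw [← hR]
    exact congrArg (· * _) (congrArg star (congrFun (hQR (Fin.cast (h.trans h'.symm) x)) z)).symm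
  -- Qᴴ sends the columns of U to the last basis vectors, so Q⁻ᴴ sends these back to U. Then A
  -- yields the last columns of P, and P⁻¹ yields basis vectors again.
  · have h₁ := star_mulVec_eq_single hn Q hUR h' hQR hQ x
    have h₂ := hP (Fin.cast (h.trans h'.symm).symm x)
    rw [Fin.cast_cast] at h₂
    rw [hcol, ← h₁, mulVec_mulVec _ (star Q)⁻¹.val, (star Q).inv_mul, one_mulVec, ← h₂,
      inv_mulVec_col]
  · rw [hcol]
    exact congrFun (h₀ y) x
  · have h₁ : reindex (blockEquiv r hm) (blockEquiv c hn)
        ((P⁻¹.val * A * (star Q)⁻¹.val).submatrix (blockEquiv r hm) (blockEquiv c hn)) =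
        P⁻¹.val * A * (star Q)⁻¹.val := by
      rw [reindex_apply, submatrix_submatrix, Equiv.self_comp_symm, Equiv.self_comp_symm,
        submatrix_id_id]
    rw [h₁, Matrix.mul_assoc, Matrix.mul_assoc (P⁻¹.val * A), (star Q).inv_mul, Matrix.mul_one,
      ← Matrix.mul_assoc, P.mul_inv, Matrix.one_mul]

end TrailingForm

/-! ### The simultaneous decomposition -/

set_option maxHeartbeats 1000000 in
theorem theorem2p2 {m n p₁ p₂ p₃ q₁ q₂ q₃ : ℕ}
    (A : Matrix (Fin m) (Fin n) ℍ[ℝ])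
    (B : Matrix (Fin m) (Fin p₁) ℍ[ℝ]) (C : Matrix (Fin m) (Fin p₂) ℍ[ℝ])
    (D : Matrix (Fin m) (Fin p₃) ℍ[ℝ])
    (E : Matrix (Fin q₁) (Fin n) ℍ[ℝ]) (F : Matrix (Fin q₂) (Fin n) ℍ[ℝ])
    (G : Matrix (Fin q₃) (Fin n) ℍ[ℝ]) :
    ∃ (t m₁ m₂ m₃ m₄ m₅ m₆ m₇ m₈ m₀ n₁ n₂ n₃ n₄ n₅ n₆ n₇ n₈ n₀ b₀ c₀ d₀ e₀ f₀ g₀ : ℕ),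
      -- the number of columns of `I_t`
      ((t : ℤ) = qrank (fromBlocks A (fromCols B (fromCols C D)) (fromRows E (fromRows F G)) 0)
        - qrank (fromCols B (fromCols C D)) - qrank (fromRows E (fromRows F G))) ∧
      -- the sizes of the block rows
      ((m₁ : ℤ) = qrank B + qrank C + qrank D
        - qrank (fromRows (fromCols D (fromCols B 0)) (fromCols D (fromCols 0 C)))) ∧
      ((m₂ : ℤ) = qrank (fromRows (fromCols D (fromCols B 0)) (fromCols D (fromCols 0 C)))
        - qrank (fromCols B C) - qrank D) ∧
      ((m₃ : ℤ) = qrank (fromRows (fromCols D (fromCols B 0)) (fromCols D (fromCols 0 C)))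
        - qrank (fromCols B D) - qrank C) ∧
      ((m₄ : ℤ) = qrank (fromCols B C) + qrank (fromCols C D) + qrank (fromCols B D)
        - qrank (fromCols B (fromCols C D))
        - qrank (fromRows (fromCols D (fromCols B 0)) (fromCols D (fromCols 0 C)))) ∧
      ((m₅ : ℤ) = qrank (fromCols B (fromCols C D)) - qrank (fromCols C D)) ∧
      ((m₆ : ℤ) = qrank (fromRows (fromCols D (fromCols B 0)) (fromCols D (fromCols 0 C)))
        - qrank (fromCols C D) - qrank B) ∧
      ((m₇ : ℤ) = qrank (fromCols B (fromCols C D)) - qrank (fromCols B D)) ∧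
      ((m₈ : ℤ) = qrank (fromCols B (fromCols C D)) - qrank (fromCols B C)) ∧
      ((m₀ : ℤ) = m - qrank (fromCols B (fromCols C D)) - t) ∧
      -- the sizes of the block columns
      ((n₁ : ℤ) = qrank E + qrank F + qrank G
        - qrank (fromRows (fromCols G G) (fromRows (fromCols E 0) (fromCols 0 F)))) ∧
      ((n₂ : ℤ) = qrank (fromRows (fromCols G G) (fromRows (fromCols E 0) (fromCols 0 F)))
        - qrank (fromRows E F) - qrank G) ∧
      ((n₃ : ℤ) = qrank (fromRows (fromCols G G) (fromRows (fromCols E 0) (fromCols 0 F)))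
        - qrank (fromRows E G) - qrank F) ∧
      ((n₄ : ℤ) = qrank (fromRows E F) + qrank (fromRows F G) + qrank (fromRows E G)
        - qrank (fromRows E (fromRows F G))
        - qrank (fromRows (fromCols G G) (fromRows (fromCols E 0) (fromCols 0 F)))) ∧
      ((n₅ : ℤ) = qrank (fromRows E (fromRows F G)) - qrank (fromRows F G)) ∧
      ((n₆ : ℤ) = qrank (fromRows (fromCols G G) (fromRows (fromCols E 0) (fromCols 0 F)))
        - qrank (fromRows F G) - qrank E) ∧
      ((n₇ : ℤ) = qrank (fromRows E (fromRows F G)) - qrank (fromRows E G)) ∧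
      ((n₈ : ℤ) = qrank (fromRows E (fromRows F G)) - qrank (fromRows E F)) ∧
      ((n₀ : ℤ) = n - qrank (fromRows E (fromRows F G)) - t) ∧
      -- the sizes of the zero block columns of `S_B, S_C, S_D` and block rows of `S_E, S_F, S_G`
      ((b₀ : ℤ) = p₁ - qrank B) ∧ ((c₀ : ℤ) = p₂ - qrank C) ∧ ((d₀ : ℤ) = p₃ - qrank D) ∧
      ((e₀ : ℤ) = q₁ - qrank E) ∧ ((f₀ : ℤ) = q₂ - qrank F) ∧ ((g₀ : ℤ) = q₃ - qrank G) ∧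
      -- these sizes partition the rows and columns of the seven matrices
      ∃ (hm : ∑ i, sizes m₁ m₂ m₃ m₄ m₅ m₆ m₇ m₈ m₀ t i = m)
        (hn : ∑ j, sizes n₁ n₂ n₃ n₄ n₅ n₆ n₇ n₈ n₀ t j = n)
        (hB : ∑ j, ![m₁, m₂, m₃, m₄, m₅, b₀] j = p₁)
        (hC : ∑ j, ![m₄, m₆, m₇, m₁, m₂, c₀] j = p₂)
        (hD : ∑ j, ![m₈, m₄, m₆, m₃, m₁, d₀] j = p₃)
        (hE : ∑ i, ![n₁, n₂, n₃, n₄, n₅, e₀] i = q₁)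
        (hF : ∑ i, ![n₄, n₆, n₇, n₁, n₂, f₀] i = q₂)
        (hG : ∑ i, ![n₈, n₄, n₆, n₃, n₁, g₀] i = q₃)
        (P : GL (Fin m) ℍ[ℝ]) (Q : GL (Fin n) ℍ[ℝ])
        (T₁ : GL (Fin p₁) ℍ[ℝ]) (T₂ : GL (Fin p₂) ℍ[ℝ]) (T₃ : GL (Fin p₃) ℍ[ℝ])
        (V₁ : GL (Fin q₁) ℍ[ℝ]) (V₂ : GL (Fin q₂) ℍ[ℝ]) (V₃ : GL (Fin q₃) ℍ[ℝ])
        (SA : Matrix (Σ i, Fin (sizes m₁ m₂ m₃ m₄ m₅ m₆ m₇ m₈ m₀ t i))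
          (Σ j, Fin (sizes n₁ n₂ n₃ n₄ n₅ n₆ n₇ n₈ n₀ t j)) ℍ[ℝ]),
        IsTrailingForm SA ∧
        A = P.val * reindex (blockEquiv _ hm) (blockEquiv _ hn) SA * Q.val ∧
        B = P.val * reindex (blockEquiv _ hm) (blockEquiv _ hB) (ofPattern pattern₁ _ _) * T₁.val ∧
        C = P.val * reindex (blockEquiv _ hm) (blockEquiv _ hC) (ofPattern pattern₂ _ _) * T₂.val ∧
        D = P.val * reindex (blockEquiv _ hm) (blockEquiv _ hD) (ofPattern pattern₃ _ _) * T₃.val ∧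
        E = V₁.val * reindex (blockEquiv _ hE) (blockEquiv _ hn) (ofPattern pattern₁ _ _)ᴴ * Q.val ∧
        F = V₂.val * reindex (blockEquiv _ hF) (blockEquiv _ hn) (ofPattern pattern₂ _ _)ᴴ * Q.val ∧
        G = V₃.val * reindex (blockEquiv _ hG) (blockEquiv _ hn) (ofPattern pattern₃ _ _)ᴴ * Q.val := by
  obtain ⟨m₁, m₂, m₃, m₄, m₅, m₆, m₇, m₈, hm₁, hmbc, hmbd, hmcd, hmb, hmc, hmd, hmw⟩ :=
    exists_triple_sizes (colSpan B) (colSpan C) (colSpan D)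
  obtain ⟨n₁, n₂, n₃, n₄, n₅, n₆, n₇, n₈, hn₁, hnbc, hnbd, hncd, hnb, hnc, hnd, hnw⟩ :=
    exists_triple_sizes (colSpan Eᴴ) (colSpan Fᴴ) (colSpan Gᴴ)
  obtain ⟨f₁, f₂, f₃, f₄, f₅, f₄', f₆, f₇, f₈, sB, sC, sD⟩ :=
    exists_triple_families hm₁ hmbc hmbd hmcd hmb hmc hmd hmw
  obtain ⟨g₁, g₂, g₃, g₄, g₅, g₄', g₆, g₇, g₈, sE, sF, sG⟩ :=
    exists_triple_families hn₁ hnbc hnbd hncd hnb hnc hnd hnw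
  -- With ρ + m₁ = r_b + r_c + r_d and its analogue for σ, the listed formulas for the mᵢ and nᵢ are
  -- linear consequences of the dimension equations.
  have hρ := qrank_fromRows_fromCols B C D
  have hσ := qrank_fromRows_fromCols Eᴴ Fᴴ Gᴴ
  rw [← qrank_fromRows_zero_eq] at hσ
  rw [← hm₁] at hρ
  rw [← hn₁] at hσ
  rw [← colSpan_fromCols C D] at hmw
  rw [← colSpan_fromCols Fᴴ Gᴴ, ← conjTranspose_fromRows_eq_fromCols_conjTranspose] at hnw
  simp only [← qrank_fromCols, finrank_colSpan, ← qrank_fromRows_eq, qrank_conjTranspose]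
    at hρ hσ hmbc hmbd hmcd hmb hmc hmd hmw hnbc hnbd hncd hnb hnc hnd hnw
  set W := fromCols B (fromCols C D) with hW
  set K := fromRows E (fromRows F G) with hK
  have cW : colSpan W = colSpan B ⊔ (colSpan C ⊔ colSpan D) := by
    rw [hW, colSpan_fromCols, colSpan_fromCols]
  have cK : colSpan Kᴴ = colSpan Eᴴ ⊔ (colSpan Fᴴ ⊔ colSpan Gᴴ) := by
    rw [hK, conjTranspose_fromRows_eq_fromCols_conjTranspose,
      conjTranspose_fromRows_eq_fromCols_conjTranspose, colSpan_fromCols, colSpan_fromCols]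
  have hbig := qrank_fromBlocks_zero A W K
  obtain ⟨t, ht⟩ := Nat.exists_eq_add_of_le (Submodule.finrank_mono (le_sup_left : colSpan W ≤
    colSpan W ⊔ (LinearMap.ker (mulVecRight K)).map (mulVecRight A)))
  rw [ht] at hbig
  obtain ⟨u, huK, hu⟩ := exists_mem_sup_span_range_eq (mulVecRight A) (colSpan W)
    (LinearMap.ker (mulVecRight K)) ht.symm
  rw [← hu] at ht
  obtain ⟨m₀, hm₀⟩ := Nat.exists_eq_add_of_le (Submodule.finrank_le
    (colSpan W ⊔ Submodule.span (ℍ[ℝ])ᵐᵒᵖ (Set.range fun i => mulVecRight A (u i))))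
  obtain ⟨f₀, hf₀⟩ := exists_sup_span_range_eq (le_top : colSpan W ⊔
    Submodule.span (ℍ[ℝ])ᵐᵒᵖ (Set.range fun i => mulVecRight A (u i)) ≤ ⊤) (by
      rw [finrank_top]; exact hm₀.symm)
  rw [finrank_op_pi, Fintype.card_fin, ht] at hm₀
  rw [sup_right_comm, cW] at hf₀
  rw [finrank_colSpan] at hm₀ hbig
  obtain ⟨b₀, hb₀⟩ := Nat.exists_eq_add_of_le (qrank_le_card B)
  obtain ⟨c₀, hc₀⟩ := Nat.exists_eq_add_of_le (qrank_le_card C)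
  obtain ⟨d₀, hd₀⟩ := Nat.exists_eq_add_of_le (qrank_le_card D)
  obtain ⟨e₀, he₀⟩ := Nat.exists_eq_add_of_le (qrank_le_card Eᴴ)
  obtain ⟨f₀', hf₀'⟩ := Nat.exists_eq_add_of_le (qrank_le_card Fᴴ)
  obtain ⟨g₀, hg₀⟩ := Nat.exists_eq_add_of_le (qrank_le_card Gᴴ)
  rw [Fintype.card_fin] at hb₀ hc₀ hd₀ he₀ hf₀' hg₀
  rw [qrank_conjTranspose] at he₀ hf₀' hg₀
  have hm : ∑ i, sizes m₁ m₂ m₃ m₄ m₅ m₆ m₇ m₈ m₀ t i = m := by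
    rw [sum_sizes]; omega
  have hB : ∑ j, ![m₁, m₂, m₃, m₄, m₅, b₀] j = p₁ := by rw [sum_six]; omega
  have hC : ∑ j, ![m₄, m₆, m₇, m₁, m₂, c₀] j = p₂ := by rw [sum_six]; omega
  have hD : ∑ j, ![m₈, m₄, m₆, m₃, m₁, d₀] j = p₃ := by rw [sum_six]; omega
  -- The last block of P consists of the vectors A uᵢ. The location of its other columns matters
  -- only for the row side below, hence the discarded conclusion.
  obtain ⟨P, T₁, T₂, T₃, hPB, hPC, hPD, hPt, -⟩ := exists_triple_normal_form B C D hm hB hC hD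
    f₁ f₂ f₃ f₄ f₅ f₄' f₆ f₇ f₈ f₀ _ sB sC sD hf₀
  let U : Matrix (Fin n) (Fin t) ℍ[ℝ] := Matrix.of fun i x => u x i
  have hPU : ∀ x, P.val.col (blockEquiv _ hm ⟨10, x⟩) = A *ᵥ U.col (Fin.cast rfl x) := hPt
  obtain ⟨R, hUR, hR⟩ := exists_conjTranspose_mul_eq_one hm A P (U := U) rfl hPU
  obtain ⟨hkU, hkR⟩ := finrank_ker_conjTranspose hUR
  have hKU : colSpan Kᴴ ≤ LinearMap.ker (mulVecRight Uᴴ) := by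
    apply colSpan_le_ker
    rw [← conjTranspose_mul, conjTranspose_eq_zero]
    exact Matrix.ext fun i x => congrFun (huK x) i
  -- Since ker Uᴴ has dimension n - t and contains col Kᴴ, the number n₀ = n - r(K) - t is the
  -- codimension of col Kᴴ in it.
  obtain ⟨n₀, hn₀⟩ := Nat.exists_eq_add_of_le (Submodule.finrank_mono hKU)
  obtain ⟨g₀', hg₀'⟩ := exists_sup_span_range_eq hKU hn₀.symm
  rw [finrank_colSpan, qrank_conjTranspose] at hn₀
  have hn : ∑ i, sizes n₁ n₂ n₃ n₄ n₅ n₆ n₇ n₈ n₀ t i = n := by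
    rw [sum_sizes]; omega
  have hE : ∑ j, ![n₁, n₂, n₃, n₄, n₅, e₀] j = q₁ := by rw [sum_six]; omega
  have hF : ∑ j, ![n₄, n₆, n₇, n₁, n₂, f₀'] j = q₂ := by rw [sum_six]; omega
  have hG : ∑ j, ![n₈, n₄, n₆, n₃, n₁, g₀] j = q₃ := by rw [sum_six]; omega
  rw [cK] at hg₀'
  obtain ⟨Q, V₁, V₂, V₃, hQE, hQF, hQG, hQt, hQ⟩ := exists_triple_normal_form Eᴴ Fᴴ Gᴴ hn hE hF hG
    g₁ g₂ g₃ g₄ g₅ g₄' g₆ g₇ g₈ g₀' R.col sE sF sG (by rw [hg₀']; exact hkR)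
  rw [hg₀'] at hQ
  replace hQE := conjTranspose_normal_form _ _ hQE
  replace hQF := conjTranspose_normal_form _ _ hQF
  replace hQG := conjTranspose_normal_form _ _ hQG
  -- Index 9 is the tenth block. These rows annihilate col W, because the tenth rows of all three
  -- tables are zero, and the vectors A uᵢ, because those are columns of P in another block.
  -- Together these span col W + A(ker K).
  let L := P⁻¹.val.submatrix (fun y => blockEquiv _ hm ⟨9, y⟩) id
  have hLA : ∀ v ∈ LinearMap.ker (mulVecRight K), L *ᵥ (A *ᵥ v) = 0 := by
    intro v hv
    suffices h : colSpan W ⊔ Submodule.span _ (Set.range fun i => mulVecRight A (u i)) ≤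
        LinearMap.ker (mulVecRight L) from
      LinearMap.mem_ker.1 (h (hu.ge (le_sup_right (a := colSpan W) (Submodule.mem_map_of_mem hv))))
    rw [cW]
    refine sup_le (sup_le (colSpan_le_ker (inv_submatrix_mul_eq_zero hm hB P hPB (by decide)))
      (sup_le (colSpan_le_ker (inv_submatrix_mul_eq_zero hm hC P hPC (by decide))) (colSpan_le_ker (inv_submatrix_mul_eq_zero hm hD P hPD (by decide)))))
      (span_range_le_iff.2 fun x => ?_)
    exact LinearMap.mem_ker.2 ((congrArg (L *ᵥ ·) (hPt x)).symm.trans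
      (inv_submatrix_mulVec_col hm P (by decide) _))
  have hKQ : ∀ y, (star Q)⁻¹.val *ᵥ Pi.single (blockEquiv _ hn ⟨9, y⟩) 1 ∈
      LinearMap.ker (mulVecRight K) := by
    intro y
    rw [LinearMap.mem_ker, mulVecRight_apply, hK, fromRows_mulVec, fromRows_mulVec,
      mulVec_inv_single_eq_zero hn hE (star Q) hQE (by decide), mulVec_inv_single_eq_zero hn hF (star Q) hQF (by decide), mulVec_inv_single_eq_zero hn hG (star Q) hQG (by decide)]
    ext i : 1
    rcases i with i | i | i <;> rfl
  obtain ⟨S, hS, hA⟩ := exists_isTrailingForm (t := t) (U := U) (R := R) hm hn A P Q rfl rfl hPU hUR hR hQt hQ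
    fun y => hLA _ (hKQ y)
  refine ⟨t, m₁, m₂, m₃, m₄, m₅, m₆, m₇, m₈, m₀, n₁, n₂, n₃, n₄, n₅, n₆, n₇, n₈, n₀, b₀, c₀, d₀,
    e₀, f₀', g₀, by omega, by omega, by omega, by omega, by omega, by omega, by omega, by omega,
    by omega, by omega, by omega, by omega, by omega, by omega, by omega, by omega, by omega,
    by omega, by omega, by omega, by omega, by omega, by omega, by omega, by omega,
    hm, hn, hB, hC, hD, hE, hF, hG, P, star Q, T₁, T₂, T₃, star V₁, star V₂, star V₃,
    S, hS, hA, hPB, hPC, hPD, hQE, hQF, hQG⟩
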